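/- **Setting.** Let $T>0$. Let $\mathcal V^1([0,T];\mathbb R^d)$ be the space of continuous paths $x\colon[0,T]\to\mathbb R^d$ of bounded variation, with the norm $\|x\|_\infty+|x|_{\mathrm{BV}}$. For $f\colon\mathbb R^{d_y}\to\mathbb R^{d_y\times d}$ Lipschitz, $\zeta\in C(\mathbb R^{d};\mathbb R^{d_y})$ and $x\in\mathcal V^1([0,T];\mathbb R^{d})$, let $z_{f,\zeta,x}\colon[0,T]\to\mathbb R^{d_y}$ be the unique continuous solution of $$z(t)=z(0)+\int_0^t f(z(s))\,\mathrm dx(s)\quad (t\in[0,T]),\qquad z(0)=\zeta(x(0)),$$ the integral being a Riemann–Stieltjes integral. The signature of $x$ consists of the iterated integrals $S^{k_1,\dots,k_j}_{0,T}(x)=\int\cdots\int_{0<t_1<\dots<t_j<T}\mathrm dx_{k_1}(t_1)\cdots\mathrm dx_{k_j}(t_j)$, and $\mathrm{Sig}^M_{0,T}(x)$ collects those with $j\le M$. A set $K\subseteq\mathcal V^1([0,T];\mathbb R^d)$ has *uniqueness of signatures* if for all distinct $x,\hat x\in K$ with $x(0)=\hat x(0)$ there is an $M$ with $\mathrm{Sig}^M_{0,T}(x)\ne\mathrm{Sig}^M_{0,T}(\hat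 x)$. Spaces $C(U;V)$ of continuous functions carry the topology of uniform convergence on compact sets, and $L(V;W)$ denotes the linear maps. **(1) Paths.** Let $d_x,d_o\in\mathbb N$ and let $K\subseteq\mathcal V^1([0,T];\mathbb R^{d_x})$ be compact with uniqueness of signatures. Then the functions in $$\bigcup_{d_y\ge1}\{x\mapsto\ell(z_{f,\zeta,x}(T)) : f\in\mathrm{Lip}(\mathbb R^{d_y};\mathbb R^{d_y\times d_x}),\ \zeta\in C(\mathbb R^{d_x};\mathbb R^{d_y}),\ \ell\in L(\mathbb R^{d_y};\mathbb R^{d_o})\}$$ are well defined and continuous on $K$, and this set is dense in $C(K;\mathbb R^{d_o})$ (in the uniform norm, as $K$ is compact). **(2) Time series.** A time series over $\mathbb R^{d_x}$ is a finite sequence $\mathbf x=((t_0,x_0),\dots,(t_n,x_n))$ with $0=t_0<t_1<\dots<t_n$ and $x_j\in(\mathbb R\cup\{*\})^{d_x}$, where $*$ marks a missing value. Put $x_{j,0}=t_j$, let $c_{j,k}(\mathbf x)$ be the number of $i\le j$ with $x_{i,k}\ne *$, and let $$\mathrm{size}(\mathbf x)=\max\Big\{n,\ \max_{j,k}|x_{j,k}|,\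 \max_{j<n,\,k}\tfrac{x_{j+1,k}-x_{j,k}}{t_{j+1}-t_j},\ \max_{j<n,\,k}\tfrac{x_{j+1,k}-x_{j,k}}{(t_{j+1}-t_j)^2}\Big\},$$ with $0\le k\le d_x$ and missing values replaced by $0$. Let $\mathcal X$ be a set of time series. An interpolation is a map $\mathcal X\to\mathcal V^1([0,T];\mathbb R^{2d_x+1})$, $\mathbf x\mapsto x_{\mathbf x}$, such that for each $\mathbf x$ there are $0=s_0<\dots<s_n=T$ with $x_{\mathbf x}(s_j)=(t_j,x_j,c_j(\mathbf x))$ for all $j$ (no condition being imposed on a coordinate whose value is missing). It is *bounded* if there is $C>0$ such that every $x_{\mathbf x}$ is the integral of a derivative $\frac{\mathrm dx_{\mathbf x}}{\mathrm dt}$ of bounded variation with $\|x_{\mathbf x}\|_\infty+\|\frac{\mathrm dx_{\mathbf x}}{\mathrm dt}\|_\infty+|\frac{\mathrm dx_{\mathbf x}}{\mathrm dt}|_{\mathrm{BV}}<C\,\mathrm{size}(\mathbf x)$ (for some choice of representative of the derivative). It is *signature-unique* if it is injective and $\mathfrak X=\{x_{\mathbf x}:\mathbf x\in\mathcal X\}$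 has uniqueness of signatures. Equip $\mathcal X$ with the weakest topology for which the interpolation is continuous. For each $d_y\ge1$ let $F_{d_y}\subseteq\mathrm{Lip}(\mathbb R^{d_y};\mathbb R^{d_y\times(2d_x+1)})$ be dense in $C(\mathbb R^{d_y};\mathbb R^{d_y\times(2d_x+1)})$ and let $\xi_{d_y}\subseteq C(\mathbb R^{2d_x+1};\mathbb R^{d_y})$ be dense in $C(\mathbb R^{2d_x+1};\mathbb R^{d_y})$ (typically classes of neural networks). Suppose that $\mathrm{size}$ is bounded on $\mathcal X$ by a constant and that $\mathbf x\mapsto x_{\mathbf x}$ is a bounded signature-unique interpolation. Then the functions in $$\bigcup_{d_y\ge1}\{\mathbf x\mapsto\ell(z_{f,\zeta,x_{\mathbf x}}(T)) : f\in F_{d_y},\ \zeta\in\xi_{d_y},\ \ell\in L(\mathbb R^{d_y};\mathbb R^{d_o})\}$$ are well defined and continuous on $\mathcal X$, and this set is dense in $C(\mathcal X;\mathbb R^{d_o})$. Moreover the closure $\overline{\mathfrak X}$ in $\mathcal V^1([0,T];\mathbb R^{2d_x+1})$ is compact, and if $\overline{\mathfrak X}$ also has uniqueness of signatures, then the functions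 $x\mapsto\ell(z_{f,\zeta,x}(T))$ with $f\in F_{d_y}$, $\zeta\in\xi_{d_y}$, $\ell\in L(\mathbb R^{d_y};\mathbb R^{d_o})$, $d_y\ge1$, are well defined and continuous on $\overline{\mathfrak X}$ and dense in $C(\overline{\mathfrak X};\mathbb R^{d_o})$ in the uniform norm. -/

import Mathlib

open Set Filter Topology
open scoped ENNReal

noncomputable section

namespace NeuralCDE

/-- `ℝ^d` with its Euclidean norm. -/
abbrev E (d : ℕ) : Type := EuclideanSpace ℝ (Fin d)

/-! ### Continuous paths of bounded variation -/

theorem eVariationOn_add_le {α F : Type*} [LinearOrder α] [SeminormedAddCommGroup F]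
    (f g : α → F) (s : Set α) :
    eVariationOn (f + g) s ≤ eVariationOn f s + eVariationOn g s := by
  refine iSup_le fun p => ?_
  calc ∑ i ∈ Finset.range p.1, edist ((f + g) (p.2.1 (i + 1))) ((f + g) (p.2.1 i))
      ≤ ∑ i ∈ Finset.range p.1, (edist (f (p.2.1 (i + 1))) (f (p.2.1 i))
          + edist (g (p.2.1 (i + 1))) (g (p.2.1 i))) :=
        Finset.sum_le_sum fun i _ => edist_add_add_le _ _ _ _
    _ = ∑ i ∈ Finset.range p.1, edist (f (p.2.1 (i + 1))) (f (p.2.1 i))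
          + ∑ i ∈ Finset.range p.1, edist (g (p.2.1 (i + 1))) (g (p.2.1 i)) :=
        Finset.sum_add_distrib
    _ ≤ _ := add_le_add (eVariationOn.sum_le p.2.2.1 p.2.2.2)
        (eVariationOn.sum_le p.2.2.1 p.2.2.2)

theorem eVariationOn_neg {α F : Type*} [LinearOrder α] [SeminormedAddCommGroup F]
    (f : α → F) (s : Set α) : eVariationOn (-f) s = eVariationOn f s := by
  simp only [eVariationOn, Pi.neg_apply, edist_neg_neg]

theorem eVariationOn_zero {α F : Type*} [LinearOrder α] [SeminormedAddCommGroup F]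
    (s : Set α) : eVariationOn (0 : α → F) s = 0 := by
  simp [eVariationOn]

/-- The continuous paths `[0, T] → ℝ^d` of bounded variation, as a subgroup of the continuous
paths. -/
def bvSubgroup (T : ℝ) (d : ℕ) : AddSubgroup C(Icc (0 : ℝ) T, E d) where
  carrier := {x | BoundedVariationOn x univ}
  add_mem' {x y} hx hy := by
    refine ne_top_of_le_ne_top (ENNReal.add_ne_top.2 ⟨hx, hy⟩) ?_
    exact eVariationOn_add_le (⇑x) (⇑y) univ
  zero_mem' := by
    have h := eVariationOn_zero (α := Icc (0 : ℝ) T) (F := E d) univ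
    exact ne_of_eq_of_ne h ENNReal.zero_ne_top
  neg_mem' {x} hx := by
    have h := eVariationOn_neg (⇑x) univ
    exact ne_of_eq_of_ne h hx

/-- The space `𝒱¹([0, T]; ℝ^d)` of continuous functions of bounded variation. It is a separate
type, so that it does not carry the supremum norm. -/
def V1 (T : ℝ) (d : ℕ) : Type := bvSubgroup T d

instance (T : ℝ) (d : ℕ) : AddCommGroup (V1 T d) :=
  inferInstanceAs (AddCommGroup (bvSubgroup T d))

/-- The underlying continuous path. -/
def V1.toCont {T : ℝ} {d : ℕ} (x : V1 T d) : C(Icc (0 : ℝ) T, E d) := x.1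

/-- The norm `‖x‖_∞ + |x|_BV` on `𝒱¹([0, T]; ℝ^d)`. -/
def V1.groupNorm (T : ℝ) (d : ℕ) : AddGroupNorm (V1 T d) where
  toFun x := ‖x.toCont‖ + (eVariationOn x.toCont univ).toReal
  map_zero' := by
    have h : (eVariationOn (0 : V1 T d).toCont univ).toReal = 0 := by
      have h0 := eVariationOn_zero (α := Icc (0 : ℝ) T) (F := E d) univ
      exact (congrArg ENNReal.toReal h0).trans ENNReal.toReal_zero
    have h' : ‖(0 : V1 T d).toCont‖ = 0 := norm_zero (E := C(Icc (0 : ℝ) T, E d))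
    rw [h, h', add_zero]
  add_le' x y := by
    have h : (eVariationOn (x + y).toCont univ).toReal
        ≤ (eVariationOn x.toCont univ).toReal + (eVariationOn y.toCont univ).toReal := by
      have hx : eVariationOn x.toCont univ ≠ ∞ := x.2
      have hy : eVariationOn y.toCont univ ≠ ∞ := y.2
      rw [← ENNReal.toReal_add hx hy]
      exact ENNReal.toReal_mono (ENNReal.add_ne_top.2 ⟨hx, hy⟩)
        (eVariationOn_add_le (⇑x.toCont) (⇑y.toCont) univ)
    have h' : ‖(x + y).toCont‖ ≤ ‖x.toCont‖ + ‖y.toCont‖ := norm_add_le x.toCont y.toCont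
    linarith
  neg' x := by
    have h : (eVariationOn (-x).toCont univ).toReal = (eVariationOn x.toCont univ).toReal :=
      congrArg ENNReal.toReal (eVariationOn_neg (⇑x.toCont) univ)
    have h' : ‖(-x).toCont‖ = ‖x.toCont‖ := norm_neg x.toCont
    rw [h, h']
  eq_zero_of_map_eq_zero' x hx := by
    have h1 : 0 ≤ ‖x.toCont‖ := norm_nonneg _
    have h2 : 0 ≤ (eVariationOn x.toCont univ).toReal := ENNReal.toReal_nonneg
    have h3 : ‖x.toCont‖ = 0 := by linarith
    exact Subtype.ext (norm_eq_zero.1 h3)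

instance (T : ℝ) (d : ℕ) : NormedAddCommGroup (V1 T d) :=
  AddGroupNorm.toNormedAddCommGroup (V1.groupNorm T d)

theorem V1.norm_def {T : ℝ} {d : ℕ} (x : V1 T d) :
    ‖x‖ = ‖x.toCont‖ + (eVariationOn x.toCont univ).toReal := rfl

/-- A continuous path on `[0, T]`, read as a function of a real time (constant outside
`[0, T]`). -/
def onReal {T : ℝ} [hT : Fact (0 < T)] {d : ℕ} (y : C(Icc (0 : ℝ) T, E d)) : ℝ → E d :=
  IccExtend hT.out.le y

/-! ### Riemann–Stieltjes integrals -/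

/-- `I` is the Riemann–Stieltjes integral `∫_a^b g(s) dx(s)`: the limit of the Riemann–Stieltjes
sums over all tagged partitions of `[a, b]` as the mesh tends to zero. The integrand is
(matrix) operator-valued and `g(s) dx(s)` is the application of `g(s)` to the increment. -/
def HasRSIntegral {V W : Type*} [NormedAddCommGroup V] [NormedSpace ℝ V]
    [NormedAddCommGroup W] [NormedSpace ℝ W]
    (g : ℝ → V →L[ℝ] W) (x : ℝ → V) (a b : ℝ) (I : W) : Prop :=
  ∀ ε > 0, ∃ δ > 0, ∀ (n : ℕ) (t ξ : ℕ → ℝ), t 0 = a → t n = b →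
    (∀ i < n, t i ≤ ξ i ∧ ξ i ≤ t (i + 1) ∧ t (i + 1) - t i < δ) →
    ‖∑ i ∈ Finset.range n, g (ξ i) (x (t (i + 1)) - x (t i)) - I‖ < ε

open Classical in
/-- The scalar Riemann–Stieltjes integral `∫_a^b g(s) dx(s)` (`0` if it does not exist). -/
def rsIntegral (g x : ℝ → ℝ) (a b : ℝ) : ℝ :=
  if h : ∃ I, HasRSIntegral (fun s => ContinuousLinearMap.mul ℝ ℝ (g s)) x a b I then
    h.choose
  else 0

/-! ### Signatures -/

/-- The iterated integral `t ↦ S^{k₁, …, k_m}_{0, t}(x)`, for the word listed backwards: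
the head of the list is `k_m`, the index of the outermost integral. -/
def iteratedIntegral {d : ℕ} (x : ℝ → E d) : List (Fin d) → ℝ → ℝ
  | [] => fun _ => 1
  | k :: w => fun t => rsIntegral (iteratedIntegral x w) (fun s => x s k) 0 t

/-- The depth-`M` signature `sig^M_{0, T}(x)`: the family of all `S^{k₁, …, k_m}_{0, T}(x)` with
`m ≤ M`, indexed by the words `[k₁, …, k_m]`. -/
def signature {T : ℝ} [Fact (0 < T)] {d : ℕ} (M : ℕ) (x : V1 T d) :
    {w : List (Fin d) // w.length ≤ M} → ℝ :=
  fun w => iteratedIntegral (onReal x.toCont) w.1.reverse T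

/-- Uniqueness of signatures: distinct paths in `K` with the same starting value have distinct
signatures at some depth. -/
def HasUniqueSignatures {T : ℝ} [Fact (0 < T)] {d : ℕ} (K : Set (V1 T d)) : Prop :=
  ∀ x ∈ K, ∀ x' ∈ K, x ≠ x' → onReal x.toCont 0 = onReal x'.toCont 0 →
    ∃ M : ℕ, signature M x ≠ signature M x'

/-! ### Controlled differential equations -/

/-- Continuous matrix fields `C(ℝ^{d_y}; ℝ^{d_y × d_x})`, a matrix being identified with the
linear map `ℝ^{d_x} → ℝ^{d_y}` that it represents. The topology is that of uniform convergence on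
compact sets. -/
abbrev VectorField (dx dy : ℕ) : Type := C(E dy, E dx →L[ℝ] E dy)

/-- The Lipschitz vector fields. -/
def lipschitzFields (dx dy : ℕ) : Set (VectorField dx dy) :=
  {f | ∃ L : NNReal, LipschitzWith L f}

/-- The continuous path `y` solves `y(t) = y(0) + ∫_0^t f(y(s)) dx(s)` on `[0, T]`, with
`y(0) = ζ(x(0))`. -/
def IsCDESolution {T : ℝ} [Fact (0 < T)] {dx dy : ℕ} (f : VectorField dx dy)
    (ζ : C(E dx, E dy)) (x : V1 T dx) (y : C(Icc (0 : ℝ) T, E dy)) : Prop :=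
  onReal y 0 = ζ (onReal x.toCont 0) ∧
  ∀ t ∈ Icc (0 : ℝ) T,
    HasRSIntegral (fun s => f (onReal y s)) (onReal x.toCont) 0 t (onReal y t - onReal y 0)

/-- `v = ℓ(z_{f, ζ, x}(T))`, where `z_{f, ζ, x}` is the unique solution of the CDE (existence and
uniqueness of the solution are part of the assertion). -/
def IsReadout {T : ℝ} [Fact (0 < T)] {dx dy m : ℕ} (f : VectorField dx dy)
    (ζ : C(E dx, E dy)) (ℓ : E dy →ₗ[ℝ] E m) (x : V1 T dx) (v : E m) : Prop :=
  ∃ z : C(Icc (0 : ℝ) T, E dy), IsCDESolution f ζ x z ∧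
    (∀ z', IsCDESolution f ζ x z' → z' = z) ∧ v = ℓ (onReal z T)

/-- The set `⋃_{d_y ≥ 1} {u ↦ ℓ(z_{f, ζ, p(u)}(T)) | f ∈ F_{d_y}, ζ ∈ Ξ_{d_y}, ℓ linear}` of
continuous functions on a space `U` whose points `u` are turned into driving paths `p(u)`. -/
def readouts {T : ℝ} [Fact (0 < T)] {dx : ℕ} {U : Type*} [TopologicalSpace U] (p : U → V1 T dx)
    (F : ∀ dy : ℕ, Set (VectorField dx dy)) (Ξ : ∀ dy : ℕ, Set C(E dx, E dy)) (m : ℕ) :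
    Set C(U, E m) :=
  {g | ∃ dy : ℕ, 1 ≤ dy ∧ ∃ f ∈ F dy, ∃ ζ ∈ Ξ dy, ∃ ℓ : E dy →ₗ[ℝ] E m,
    ∀ u, IsReadout f ζ ℓ (p u) (g u)}

/-- Universal approximation: every function `u ↦ ℓ(z_{f, ζ, p(u)}(T))` is well defined and
continuous on `U`, and these functions are dense in `C(U; ℝ^m)` for the topology of uniform
convergence on compact sets (which is that of uniform convergence when `U` is compact). -/
def UniversalApproximation {T : ℝ} [Fact (0 < T)] {dx : ℕ} {U : Type*} [TopologicalSpace U]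
    (p : U → V1 T dx) (F : ∀ dy : ℕ, Set (VectorField dx dy))
    (Ξ : ∀ dy : ℕ, Set C(E dx, E dy)) (m : ℕ) : Prop :=
  (∀ dy : ℕ, 1 ≤ dy → ∀ f ∈ F dy, ∀ ζ ∈ Ξ dy, ∀ ℓ : E dy →ₗ[ℝ] E m,
    ∃ g : C(U, E m), ∀ u, IsReadout f ζ ℓ (p u) (g u)) ∧
  Dense (readouts p F Ξ m)

/-! ### Time series and their interpolations -/

/-- Irregularly sampled time series `((t_0, x_0), …, (t_n, x_n))` over `ℝ^d` with `t_0 = 0`,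
`t_j < t_{j+1}` and `x_j ∈ (ℝ ∪ {*})^d`; a missing value `*` is `none`. -/
structure TimeSeries (d : ℕ) where
  n : ℕ
  t : Fin (n + 1) → ℝ
  x : Fin (n + 1) → Fin d → Option ℝ
  t_zero : t 0 = 0
  t_strictMono : StrictMono t

/-- `x_{j, k}` for `0 ≤ k ≤ d`, where `x_{j, 0} = t_j` and missing values are replaced by `0`. -/
def TimeSeries.channel {d : ℕ} (τ : TimeSeries d) (j : Fin (τ.n + 1)) : Fin (d + 1) → ℝ :=
  Fin.cons (τ.t j) fun k => (τ.x j k).getD 0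

/-- The size of a time series: the maximum of `n`, of the `|x_{j, k}|`, of the
`(x_{j+1, k} - x_{j, k}) / (t_{j+1} - t_j)` and of the
`(x_{j+1, k} - x_{j, k}) / (t_{j+1} - t_j)^2` (a finite nonempty set of numbers). -/
def TimeSeries.size {d : ℕ} (τ : TimeSeries d) : ℝ :=
  sSup ({(τ.n : ℝ)}
    ∪ range (fun p : Fin (τ.n + 1) × Fin (d + 1) => |τ.channel p.1 p.2|)
    ∪ range (fun p : Fin τ.n × Fin (d + 1) =>
        (τ.channel p.1.succ p.2 - τ.channel p.1.castSucc p.2)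
          / (τ.t p.1.succ - τ.t p.1.castSucc))
    ∪ range (fun p : Fin τ.n × Fin (d + 1) =>
        (τ.channel p.1.succ p.2 - τ.channel p.1.castSucc p.2)
          / (τ.t p.1.succ - τ.t p.1.castSucc) ^ 2))

/-- `c_{j, k}`: the number of observations in channel `k` by time `t_j`. -/
def TimeSeries.count {d : ℕ} (τ : TimeSeries d) (j : Fin (τ.n + 1)) (k : Fin d) : ℕ :=
  (Finset.univ.filter fun i : Fin (τ.n + 1) => i ≤ j ∧ (τ.x i k).isSome).card

/-- The coordinate of `ℝ^{2d+1} = ℝ × ℝ^d × ℝ^d` that holds the time. -/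
def timeCoord (d : ℕ) : Fin (2 * d + 1) := ⟨0, by omega⟩

/-- The coordinate of `ℝ^{2d+1} = ℝ × ℝ^d × ℝ^d` that holds the value of channel `k`. -/
def valueCoord {d : ℕ} (k : Fin d) : Fin (2 * d + 1) := ⟨1 + k, by omega⟩

/-- The coordinate of `ℝ^{2d+1} = ℝ × ℝ^d × ℝ^d` that holds the observation count of
channel `k`. -/
def countCoord {d : ℕ} (k : Fin d) : Fin (2 * d + 1) := ⟨1 + d + k, by omega⟩

/-- An interpolation `τ ↦ x_τ` of the time series in a set `dom` by paths in
`𝒱¹([0, T]; ℝ^{2d+1})`: for each `τ` there are `0 = s_0 < ⋯ < s_n = T` with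
`x_τ(s_j) = (t_j, x_j, c_j(τ))`, up to missing values. -/
structure Interpolation (d : ℕ) (T : ℝ) [Fact (0 < T)] where
  dom : Set (TimeSeries d)
  path : dom → V1 T (2 * d + 1)
  knots : ∀ τ : dom, ∃ s : Fin (τ.1.n + 1) → ℝ,
    StrictMono s ∧ s 0 = 0 ∧ s (Fin.last τ.1.n) = T ∧
    ∀ j, onReal (path τ).toCont (s j) (timeCoord d) = τ.1.t j ∧
      ∀ k, (∀ v, τ.1.x j k = some v → onReal (path τ).toCont (s j) (valueCoord k) = v) ∧
        onReal (path τ).toCont (s j) (countCoord k) = τ.1.count j k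

/-- The weakest topology on the set of time series for which the interpolation is continuous. -/
instance {d : ℕ} {T : ℝ} [Fact (0 < T)] (I : Interpolation d T) : TopologicalSpace I.dom :=
  TopologicalSpace.induced I.path inferInstance

/-- Bounded interpolation: for some `C > 0`, every `x_τ` is the integral of a derivative `v` of
bounded variation with `‖x_τ‖_∞ + ‖v‖_∞ + |v|_BV < C size(τ)`. (The derivative is determined up to
null sets, so that for example piecewise linear paths are included.) -/
def Interpolation.IsBounded {d : ℕ} {T : ℝ} [Fact (0 < T)] (I : Interpolation d T) : Prop :=
  ∃ C : ℝ, 0 < C ∧ ∀ τ : I.dom, ∃ v : ℝ → E (2 * d + 1),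
    BoundedVariationOn v (Icc 0 T) ∧
    (∀ t ∈ Icc (0 : ℝ) T, onReal (I.path τ).toCont t
      = onReal (I.path τ).toCont 0 + ∫ s in (0 : ℝ)..t, v s) ∧
    ‖(I.path τ).toCont‖ + (⨆ t : Icc (0 : ℝ) T, ‖v t‖) + (eVariationOn v (Icc 0 T)).toReal
      < C * τ.1.size

/-- Signature-unique interpolation. -/
def Interpolation.IsSignatureUnique {d : ℕ} {T : ℝ} [Fact (0 < T)]
    (I : Interpolation d T) : Prop :=
  Function.Injective I.path ∧ HasUniqueSignatures (range I.path)

end NeuralCDE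

end

namespace NeuralCDE

/-! ### From local to global estimates -/

/-! The readouts of linear controlled equations are already dense; general fields enter only by
perturbation. If `dy = A y dx` and `dz = B z dx`, the stacked vector `(y, z)` and, by the product
rule, the products `y_i z_k` again solve linear equations driven by `x`. Hence linear functionals of
terminal values, with initial values depending continuously on `x(0)`, form an algebra containing
the constants. It contains every continuous function of `x(0)` and every iterated integral of `x`,
since each iterated integral is the last variable of a triangular linear system. With uniqueness of
signatures this algebra separates paths, and Stone–Weierstrass on compact sets, applied coordinate
by coordinate, gives density (`linearReadoutAlgebra_separatesPoints`, `exists_isReadout_near`).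
Linear fields are Lipschitz, which settles the first part.

For dense classes of fields and initial maps, the target solution stays in a fixed ball for all
driving paths of bounded norm, so approximation on a compact cube suffices: Gronwall keeps the
perturbed solution inside that cube (`exists_isReadout_perturbation`). For time series the induced
topology makes the interpolation continuous, and density for uniform convergence on compact sets
only tests compact sets of data. The closure of the interpolated paths is compact because
derivatives uniformly bounded in supremum and variation can be sampled on a finite grid with small
error in the norm of `𝒱¹`, which is complete (`totallyBounded_of_isBVDerivative`).

The analysis rests on one device. For a continuous integrand, being a Riemann–Stieltjes primitive is
equivalent to the local estimate `IsPrimitive`: the increments of `y` are `g dx` up to a uniform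
`o(dc)`, where the continuous monotone `c` dominates the increments of `x`. Such estimates can be
added and multiplied, and the present lemma integrates them to global inequalities, among them
Gronwall's. -/

theorem le_of_forall_local_le {q b : ℝ → ℝ} {T : ℝ} (hT : 0 ≤ T)
    (h : ∀ ε > 0, ∃ δ > 0, ∀ s t, 0 ≤ s → s ≤ t → t ≤ T → t - s < δ →
      q t ≤ q s + ε * (b t - b s)) : q T ≤ q 0 := by
  have key : ∀ ε > 0, q T ≤ q 0 + ε * (b T - b 0) := by
    intro ε hε
    obtain ⟨δ, hδ, H⟩ := h ε hε
    obtain ⟨N, hN⟩ := exists_nat_gt (T / δ)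
    have hN0 : (0 : ℝ) < N := lt_of_le_of_lt (by positivity) hN
    have hstep : T / N < δ := by
      rw [div_lt_iff₀ hN0]
      rw [div_lt_iff₀ hδ] at hN
      linarith
    have hpos : 0 ≤ T / N := by positivity
    have : ∀ i : ℕ, i ≤ N → q (i * (T / N)) ≤ q 0 + ε * (b (i * (T / N)) - b 0) := by
      intro i
      induction i with
      | zero => intro _; simp
      | succ i ih =>
        intro hi
        have h1 := ih (by omega)
        have h2 : ((i + 1 : ℕ) : ℝ) * (T / N) = i * (T / N) + T / N := by push_cast; ring
        have h3 : ((i + 1 : ℕ) : ℝ) * (T / N) ≤ N * (T / N) := by gcongr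
        have h4 : (N : ℝ) * (T / N) = T := by field_simp
        have h5 := H (i * (T / N)) ((i + 1 : ℕ) * (T / N)) (by positivity) (by linarith)
          (by linarith) (by linarith)
        linarith
    have h4 : (N : ℝ) * (T / N) = T := by field_simp
    simpa [h4] using this N le_rfl
  by_contra! hlt
  rcases le_or_gt (b T - b 0) 0 with hb | hb
  · have := key 1 one_pos
    linarith
  -- This `ε` makes the accumulated error half of the supposed gap `q T - q 0`.
  · have := key ((q T - q 0) / (2 * (b T - b 0))) (by apply div_pos <;> linarith)
    have e : (q T - q 0) / (2 * (b T - b 0)) * (b T - b 0) = (q T - q 0) / 2 := by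
      field_simp
    rw [e] at this
    linarith

/-- A Gronwall inequality with respect to a monotone function `c`. -/
theorem gronwall_of_local {q a b c : ℝ → ℝ} {T L : ℝ} (hT : 0 ≤ T) (hL : 0 ≤ L)
    (hq : ∀ t, 0 ≤ q t) (ha : Monotone a) (hb : Monotone b) (hc : Monotone c)
    (h : ∀ ε > 0, ∃ δ > 0, ∀ s t, 0 ≤ s → s ≤ t → t ≤ T → t - s < δ →
      q t ≤ q s + L * q s * (c t - c s) + (a t - a s) + ε * (b t - b s)) :
    q T ≤ (q 0 + (a T - a 0)) * Real.exp (L * (c T - c 0)) := by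
  -- The integrating factor `exp (-(L * (c t - c 0)))` cancels the growth term; being at most `1`,
  -- it lets the inhomogeneity be absorbed by subtracting `a` unweighted.
  have key := le_of_forall_local_le (q := fun t => q t * Real.exp (-(L * (c t - c 0))) - a t)
    (b := b) hT ?_
  · simp only [sub_self, mul_zero, neg_zero, Real.exp_zero, mul_one] at key
    have h1 : q T * Real.exp (-(L * (c T - c 0))) ≤ q 0 + (a T - a 0) := by linarith
    rw [Real.exp_neg, ← div_eq_mul_inv, div_le_iff₀ (Real.exp_pos _)] at h1
    exact h1
  · intro ε hε
    obtain ⟨δ, hδ, H⟩ := h ε hε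
    refine ⟨δ, hδ, fun s t hs hst ht hd => ?_⟩
    have h1 := H s t hs hst ht hd
    have hcs : 0 ≤ c t - c s := sub_nonneg.2 (hc hst)
    have has : 0 ≤ a t - a s := sub_nonneg.2 (ha hst)
    have hbs : 0 ≤ ε * (b t - b s) := mul_nonneg hε.le (sub_nonneg.2 (hb hst))
    set e := Real.exp (-(L * (c t - c 0))) with he
    have e0 : 0 < e := Real.exp_pos _
    have e1 : e ≤ 1 := Real.exp_le_one_iff.2
      (neg_nonpos.2 (mul_nonneg hL (sub_nonneg.2 (hc (hs.trans hst)))))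
    have e2 : Real.exp (-(L * (c s - c 0))) = Real.exp (L * (c t - c s)) * e := by
      rw [he, ← Real.exp_add]; ring_nf
    have e3 : 1 + L * (c t - c s) ≤ Real.exp (L * (c t - c s)) := by
      linarith [Real.add_one_le_exp (L * (c t - c s))]
    have h2 : q t * e ≤ (q s + L * q s * (c t - c s)) * e + (a t - a s) + ε * (b t - b s) := by
      calc q t * e ≤ (q s + L * q s * (c t - c s) + (a t - a s) + ε * (b t - b s)) * e := by gcongr
        _ = (q s + L * q s * (c t - c s)) * e + ((a t - a s) + ε * (b t - b s)) * e := by ring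
        _ ≤ (q s + L * q s * (c t - c s)) * e + ((a t - a s) + ε * (b t - b s)) * 1 := by
            gcongr
        _ = _ := by ring
    have h3 : (q s + L * q s * (c t - c s)) * e ≤ q s * Real.exp (-(L * (c s - c 0))) := by
      rw [e2]
      calc _ = q s * ((1 + L * (c t - c s)) * e) := by ring
        _ ≤ _ := by
          have := hq s
          gcongr
    linarith

/-! ### Primitives with respect to a path of bounded variation -/

section Primitive

variable {V W : Type*} [NormedAddCommGroup V] [NormedSpace ℝ V] [NormedAddCommGroup W]
  [NormedSpace ℝ W]

/-- The continuous monotone function `c` controls the increments of `x`. -/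
structure IsControl (x : ℝ → V) (c : ℝ → ℝ) : Prop where
  continuous : Continuous c
  monotone : Monotone c
  norm_sub_le : ∀ s t, s ≤ t → ‖x t - x s‖ ≤ c t - c s

/-- On `[0, T]`, the increments of `y` are those of `g dx`, up to an error that is small compared
with the increments of the control `c`. -/
def IsPrimitive (T : ℝ) (c : ℝ → ℝ) (g : ℝ → V →L[ℝ] W) (x : ℝ → V) (y : ℝ → W) : Prop :=
  ∀ ε > 0, ∃ δ > 0, ∀ s ξ t, 0 ≤ s → s ≤ ξ → ξ ≤ t → t ≤ T → t - s < δ →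
    ‖y t - y s - g ξ (x t - x s)‖ ≤ ε * (c t - c s)

/-- Integrate `h` against the Stieltjes measure of `F`. The interval `(s, t]` has mass `F t - F s`,
so uniform continuity of `h` gives the estimate. -/
theorem exists_primitive_of_monotone [CompleteSpace W] {h : ℝ → W} {T : ℝ}
    (hh : ContinuousOn h (Icc 0 T)) {F : ℝ → ℝ} (hF : Monotone F) (hFc : Continuous F) :
    ∃ Y : ℝ → W, ∀ ε > 0, ∃ δ > 0, ∀ s ξ t, 0 ≤ s → s ≤ ξ → ξ ≤ t → t ≤ T → t - s < δ →
      ‖Y t - Y s - (F t - F s) • h ξ‖ ≤ ε * (F t - F s) := by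
  let S : StieltjesFunction ℝ := ⟨F, hF, fun x => hFc.continuousWithinAt⟩
  refine ⟨fun t => ∫ r in Ioc 0 t, h r ∂S.measure, fun ε hε => ?_⟩
  have huc := isCompact_Icc.uniformContinuousOn_of_continuous hh
  rw [Metric.uniformContinuousOn_iff_le] at huc
  obtain ⟨δ, hδ, H⟩ := huc ε hε
  refine ⟨δ, hδ, fun s ξ t hs hsξ hξt ht hd => ?_⟩
  have hint : ∀ u v, 0 ≤ u → v ≤ T → MeasureTheory.IntegrableOn h (Ioc u v) S.measure :=
    fun u v hu hv => ((hh.mono (Icc_subset_Icc hu hv)).integrableOn_Icc).mono_set Ioc_subset_Icc_self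
  have h1 : ∫ r in Ioc 0 t, h r ∂S.measure
      = ∫ r in Ioc 0 s, h r ∂S.measure + ∫ r in Ioc s t, h r ∂S.measure := by
    rw [← MeasureTheory.setIntegral_union (Ioc_disjoint_Ioc_of_le le_rfl) measurableSet_Ioc
      (hint 0 s le_rfl (by linarith)) (hint s t hs ht), Ioc_union_Ioc_eq_Ioc hs (hsξ.trans hξt)]
  have hFst : 0 ≤ F t - F s := sub_nonneg.2 (hF (hsξ.trans hξt))
  have hm : S.measure (Ioc s t) = ENNReal.ofReal (F t - F s) := S.measure_Ioc s t
  have hmr : S.measure.real (Ioc s t) = F t - F s := by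
    rw [MeasureTheory.measureReal_def, hm, ENNReal.toReal_ofReal hFst]
  have h2 : (F t - F s) • h ξ = ∫ _ in Ioc s t, h ξ ∂S.measure := by
    rw [MeasureTheory.setIntegral_const, hmr]
  have hfin : S.measure (Ioc s t) < ∞ := by rw [hm]; exact ENNReal.ofReal_lt_top
  beta_reduce
  rw [h1, add_sub_cancel_left, h2, ← MeasureTheory.integral_sub (hint s t hs ht)
    (MeasureTheory.integrableOn_const hfin.ne), ← hmr]
  refine MeasureTheory.norm_setIntegral_le_of_norm_le_const hfin fun r hr => ?_
  rw [← dist_eq_norm]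
  refine H r ⟨by linarith [hr.1], by linarith [hr.2]⟩ ξ ⟨by linarith, by linarith⟩ ?_
  rw [Real.dist_eq, abs_le]
  constructor <;> linarith [hr.1, hr.2]

namespace IsPrimitive

variable {T : ℝ} {c : ℝ → ℝ} {g g' : ℝ → V →L[ℝ] W} {x : ℝ → V} {y y' : ℝ → W}

theorem congr (h : IsPrimitive T c g x y) (hg : EqOn g g' (Icc 0 T)) (hy : EqOn y y' (Icc 0 T)) :
    IsPrimitive T c g' x y' := by
  intro ε hε
  obtain ⟨δ, hδ, H⟩ := h ε hε
  refine ⟨δ, hδ, fun s ξ t h0 h1 h2 h3 hd => ?_⟩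
  rw [← hg ⟨h0.trans h1, h2.trans h3⟩, ← hy ⟨h0, h1.trans (h2.trans h3)⟩,
    ← hy ⟨h0.trans (h1.trans h2), h3⟩]
  exact H s ξ t h0 h1 h2 h3 hd

theorem add_const (h : IsPrimitive T c g x y) (w : W) :
    IsPrimitive T c g x (fun t => y t + w) := by
  simpa [IsPrimitive] using h

theorem const (hc : Monotone c) (w : W) : IsPrimitive T c (fun _ => (0 : V →L[ℝ] W)) x (fun _ => w) := by
  intro ε hε
  refine ⟨1, one_pos, fun s ξ t _ h1 h2 _ _ => ?_⟩
  simpa using mul_nonneg hε.le (sub_nonneg.2 (hc (h1.trans h2)))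

theorem add (h : IsPrimitive T c g x y) (h' : IsPrimitive T c g' x y') :
    IsPrimitive T c (fun s => g s + g' s) x (fun s => y s + y' s) := by
  intro ε hε
  obtain ⟨δ, hδ, H⟩ := h (ε / 2) (by positivity)
  obtain ⟨δ', hδ', H'⟩ := h' (ε / 2) (by positivity)
  refine ⟨min δ δ', lt_min hδ hδ', fun s ξ t h0 h1 h2 h3 hd => ?_⟩
  have e1 := H s ξ t h0 h1 h2 h3 (hd.trans_le (min_le_left _ _))
  have e2 := H' s ξ t h0 h1 h2 h3 (hd.trans_le (min_le_right _ _))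
  have : y t + y' t - (y s + y' s) - (g ξ + g' ξ) (x t - x s)
      = (y t - y s - g ξ (x t - x s)) + (y' t - y' s - g' ξ (x t - x s)) := by
    rw [_root_.add_apply]; abel
  rw [this]
  refine (norm_add_le _ _).trans ?_
  linarith

theorem clm_comp {W' : Type*} [NormedAddCommGroup W'] [NormedSpace ℝ W'] (A : W →L[ℝ] W')
    (hc : Monotone c) (h : IsPrimitive T c g x y) :
    IsPrimitive T c (fun s => A.comp (g s)) x (fun s => A (y s)) := by
  intro ε hε
  obtain ⟨δ, hδ, H⟩ := h (ε / (‖A‖ + 1)) (by positivity)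
  refine ⟨δ, hδ, fun s ξ t h0 h1 h2 h3 hd => ?_⟩
  have e := H s ξ t h0 h1 h2 h3 hd
  have hcs : 0 ≤ c t - c s := sub_nonneg.2 (hc (h1.trans h2))
  have : A (y t) - A (y s) - (A.comp (g ξ)) (x t - x s) = A (y t - y s - g ξ (x t - x s)) := by
    simp [map_sub]
  rw [this]
  calc _ ≤ ‖A‖ * (ε / (‖A‖ + 1) * (c t - c s)) := A.le_opNorm_of_le e
    _ = (‖A‖ / (‖A‖ + 1)) * (ε * (c t - c s)) := by ring
    _ ≤ 1 * (ε * (c t - c s)) := by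
      gcongr
      rw [div_le_one (by positivity)]; linarith
    _ = _ := one_mul _

/-- The increments of a primitive of a bounded integrand. -/
theorem norm_sub_le_of_norm_le (h : IsPrimitive T c g x y) (hx : IsControl x c) {a : ℝ → ℝ}
    (ha : ∀ s t, 0 ≤ s → s ≤ t → t ≤ T → ‖g s‖ * (c t - c s) ≤ a t - a s) {t : ℝ} (ht0 : 0 ≤ t)
    (ht : t ≤ T) : ‖y t - y 0‖ ≤ a t - a 0 := by
  have := le_of_forall_local_le (q := fun t => ‖y t - y 0‖ - a t) (b := c) ht0 ?_
  · simp only [sub_self, norm_zero] at this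
    linarith
  · intro ε hε
    obtain ⟨δ, hδ, H⟩ := h ε hε
    refine ⟨δ, hδ, fun s u hs hsu hu hd => ?_⟩
    have e := H s s u hs le_rfl hsu (hu.trans ht) hd
    have e1 : ‖y u - y 0‖ ≤ ‖y s - y 0‖ + ‖y u - y s - g s (x u - x s)‖ + ‖g s (x u - x s)‖ := by
      have : y u - y 0 = (y s - y 0) + (y u - y s - g s (x u - x s)) + g s (x u - x s) := by abel
      rw [this]
      exact norm_add₃_le
    have e2 : ‖g s (x u - x s)‖ ≤ ‖g s‖ * (c u - c s) :=
      (g s).le_opNorm_of_le (hx.norm_sub_le s u hsu)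
    have := ha s u hs hsu (hu.trans ht)
    linarith

theorem sub (hc : Monotone c) (h : IsPrimitive T c g x y) (h' : IsPrimitive T c g' x y') :
    IsPrimitive T c (fun s => g s - g' s) x (fun s => y s - y' s) := by
  have := h.add (h'.clm_comp (-ContinuousLinearMap.id ℝ W) hc)
  convert this using 2
  · ext v; simp [sub_eq_add_neg]
  · simp [sub_eq_add_neg]

theorem continuousOn (h : IsPrimitive T c g x y) (hx : IsControl x c) : ContinuousOn y (Icc 0 T) := by
  obtain ⟨δ, hδ, H⟩ := h 1 one_pos
  -- The tag is free, so at a base point `s` it can be taken equal to `s` on either side: the single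
  -- value `‖g s‖` then controls all nearby increments.
  have hinc : ∀ s t ξ, s ∈ Icc 0 T → t ∈ Icc 0 T → ξ ∈ uIcc s t → |t - s| < δ →
      ‖y t - y s‖ ≤ (‖g ξ‖ + 1) * |c t - c s| := by
    have aux : ∀ s t ξ, 0 ≤ s → t ≤ T → s ≤ ξ → ξ ≤ t → t - s < δ →
        ‖y t - y s‖ ≤ (‖g ξ‖ + 1) * |c t - c s| := by
      intro s t ξ hs ht h1 h2 hd
      have e := H s ξ t hs h1 h2 ht hd
      have e2 : ‖g ξ (x t - x s)‖ ≤ ‖g ξ‖ * (c t - c s) :=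
        (g ξ).le_opNorm_of_le (hx.norm_sub_le s t (h1.trans h2))
      have e3 : ‖y t - y s‖ ≤ ‖y t - y s - g ξ (x t - x s)‖ + ‖g ξ (x t - x s)‖ := by
        simpa using norm_add_le (y t - y s - g ξ (x t - x s)) (g ξ (x t - x s))
      have e4 : c t - c s ≤ |c t - c s| := le_abs_self _
      nlinarith [norm_nonneg (g ξ)]
    intro s t ξ hs ht hξ hd
    rcases le_total s t with hst | hst
    · rw [uIcc_of_le hst] at hξ
      exact aux s t ξ hs.1 ht.2 hξ.1 hξ.2 (lt_of_abs_lt hd)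
    · rw [uIcc_of_ge hst] at hξ
      rw [norm_sub_rev, abs_sub_comm (c t)]
      exact aux t s ξ ht.1 hs.2 hξ.1 hξ.2 (by rw [abs_sub_comm] at hd; exact lt_of_abs_lt hd)
  intro s hs
  rw [ContinuousWithinAt, tendsto_iff_norm_sub_tendsto_zero]
  have hlim : Tendsto (fun t => (‖g s‖ + 1) * |c t - c s|) (𝓝[Icc 0 T] s) (𝓝 0) := by
    have : Continuous fun t => (‖g s‖ + 1) * |c t - c s| := by
      have := hx.continuous
      fun_prop
    simpa using (this.tendsto s).mono_left nhdsWithin_le_nhds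
  refine squeeze_zero' (Eventually.of_forall fun t => norm_nonneg _) ?_ hlim
  have : ∀ᶠ t in 𝓝[Icc 0 T] s, |t - s| < δ :=
    nhdsWithin_le_nhds (Metric.ball_mem_nhds s hδ)
  filter_upwards [this, self_mem_nhdsWithin] with t h1 h2
  exact hinc s t s hs h2 left_mem_uIcc h1

/-- Over a tagged partition both the increments of `y` and the error bounds `ε dc` telescope. -/
theorem hasRSIntegral (h : IsPrimitive T c g x y) (hc : Monotone c) {t : ℝ} (ht : t ∈ Icc 0 T) :
    HasRSIntegral g x 0 t (y t - y 0) := by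
  intro ε hε
  obtain ⟨δ, hδ, H⟩ := h (ε / (c t - c 0 + 1))
    (div_pos hε (by linarith [hc ht.1]))
  refine ⟨δ, hδ, fun n u ξ h0 hn hu => ?_⟩
  have hmono : ∀ i ≤ n, ∀ j ≤ i, u j ≤ u i := by
    intro i
    induction i with
    | zero => intro _ j hj; simp at hj; simp [hj]
    | succ i ih =>
      intro hi j hj
      have := hu i (by omega)
      rcases Nat.le_succ_iff.1 hj with h | h
      · exact (ih (by omega) j h).trans (this.1.trans this.2.1)
      · rw [h]
  have e1 : y t - y 0 = ∑ i ∈ Finset.range n, (y (u (i + 1)) - y (u i)) := by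
    rw [Finset.sum_range_sub (fun i => y (u i)), h0, hn]
  have e2 : c t - c 0 = ∑ i ∈ Finset.range n, (c (u (i + 1)) - c (u i)) := by
    rw [Finset.sum_range_sub (fun i => c (u i)), h0, hn]
  have hct : 0 ≤ c t - c 0 := sub_nonneg.2 (hc ht.1)
  rw [e1, ← Finset.sum_sub_distrib]
  calc _ ≤ ∑ i ∈ Finset.range n, ε / (c t - c 0 + 1) * (c (u (i + 1)) - c (u i)) := by
        refine norm_sum_le_of_le _ fun i hi => ?_
        rw [Finset.mem_range] at hi
        rw [norm_sub_rev]
        have h1 := hmono i hi.le 0 (Nat.zero_le _)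
        have h2 := hmono n le_rfl (i + 1) hi
        rw [h0] at h1
        rw [hn] at h2
        exact H _ _ _ h1 (hu i hi).1 (hu i hi).2.1 (h2.trans ht.2) (hu i hi).2.2
    _ = ε * ((c t - c 0) / (c t - c 0 + 1)) := by rw [← Finset.mul_sum, ← e2]; ring
    _ < ε * 1 := by
        gcongr
        rw [div_lt_one (by linarith)]; linarith
    _ = ε := mul_one _

end IsPrimitive

theorem HasRSIntegral.unique {g : ℝ → V →L[ℝ] W} {x : ℝ → V} {t : ℝ} (ht : 0 ≤ t) {I J : W}
    (hI : HasRSIntegral g x 0 t I) (hJ : HasRSIntegral g x 0 t J) : I = J := by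
  by_contra hne
  have hε : 0 < ‖I - J‖ / 2 := by
    have : 0 < ‖I - J‖ := norm_pos_iff.2 (sub_ne_zero.2 hne)
    positivity
  obtain ⟨δ, hδ, H⟩ := hI _ hε
  obtain ⟨δ', hδ', H'⟩ := hJ _ hε
  obtain ⟨N, hN⟩ := exists_nat_gt (t / min δ δ')
  have hm : 0 < min δ δ' := lt_min hδ hδ'
  have hN0 : (0 : ℝ) < N := lt_of_le_of_lt (by positivity) hN
  have hstep : t / N < min δ δ' := by
    rw [div_lt_iff₀ hN0]
    rw [div_lt_iff₀ hm] at hN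
    linarith
  have hpos : 0 ≤ t / N := by positivity
  have e : ∀ i : ℕ, ((i + 1 : ℕ) : ℝ) * (t / N) = i * (t / N) + t / N := by
    intro i; push_cast; ring
  have hend : (N : ℝ) * (t / N) = t := by field_simp
  have a1 := H N (fun i => i * (t / N)) (fun i => i * (t / N)) (by simp) hend
    fun i _ => ⟨le_rfl, by simp only [e]; linarith, by
      simp only [e]; linarith [min_le_left δ δ']⟩
  have a2 := H' N (fun i => i * (t / N)) (fun i => i * (t / N)) (by simp) hend
    fun i _ => ⟨le_rfl, by simp only [e]; linarith, by
      simp only [e]; linarith [min_le_right δ δ']⟩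
  set S := ∑ i ∈ Finset.range N, g (i * (t / N))
    (x ((i + 1 : ℕ) * (t / N)) - x (i * (t / N)))
  have a3 : ‖I - J‖ ≤ ‖S - I‖ + ‖S - J‖ := by
    have : I - J = (S - J) - (S - I) := by abel
    rw [this, add_comm]
    exact norm_sub_le _ _
  linarith

end Primitive

/-- A control provides a Jordan decomposition with continuous parts, `x_k = c - (c - x_k)`, so each
coordinate reduces to two monotone integrators. -/
theorem exists_isPrimitive {d : ℕ} {W : Type*} [NormedAddCommGroup W] [NormedSpace ℝ W]
    [CompleteSpace W] {T : ℝ} {c : ℝ → ℝ} {g : ℝ → E d →L[ℝ] W} {x : ℝ → E d}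
    (hg : ContinuousOn g (Icc 0 T)) (hx : IsControl x c) (hxc : Continuous x) :
    ∃ y, IsPrimitive T c g x y := by
  let e : Fin d → E d := fun k => EuclideanSpace.single k 1
  have hgk : ∀ k, ContinuousOn (fun s => g s (e k)) (Icc 0 T) := fun k =>
    hg.clm_apply continuousOn_const
  have hcoord : ∀ k s t, s ≤ t → |x t k - x s k| ≤ c t - c s := fun k s t hst => by
    have := PiLp.norm_apply_le (x t - x s) k
    simpa using this.trans (hx.norm_sub_le s t hst)
  have hmono : ∀ k, Monotone fun s => c s - x s k := fun k s t hst => by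
    have := abs_le.1 (hcoord k s t hst)
    simp only
    linarith
  have hxk : ∀ k, Continuous fun s => c s - x s k := fun k => by
    have := hx.continuous
    fun_prop
  choose Y hY using fun k => exists_primitive_of_monotone (hgk k) hx.monotone hx.continuous
  choose Z hZ using fun k => exists_primitive_of_monotone (hgk k) (hmono k) (hxk k)
  refine ⟨fun t => ∑ k, (Y k t - Z k t), fun ε hε => ?_⟩
  -- Each coordinate contributes an error against `dc` and one against `d(c - x_k) ≤ 2 dc`, hence
  -- the `3`; `d + 1` also covers `d = 0`.
  have hε' : 0 < ε / (3 * (d + 1)) := by positivity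
  choose δ hδ H using fun k => hY k _ hε'
  choose δ' hδ' H' using fun k => hZ k _ hε'
  obtain ⟨η, hη, hη1⟩ : ∃ η > 0, ∀ k, η ≤ min (δ k) (δ' k) := by
    rcases isEmpty_or_nonempty (Fin d) with h | h
    · exact ⟨1, one_pos, fun k => h.elim k⟩
    · obtain ⟨k0, hk0⟩ := Finite.exists_min fun k => min (δ k) (δ' k)
      exact ⟨_, lt_min (hδ k0) (hδ' k0), hk0⟩
  refine ⟨η, hη, fun s ξ t h0 h1 h2 h3 hd => ?_⟩
  have hcst : 0 ≤ c t - c s := sub_nonneg.2 (hx.monotone (h1.trans h2))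
  have hxe : x t - x s = ∑ k, (x t k - x s k) • e k := by
    ext j
    simp [e, Finset.sum_apply, Pi.single_apply]
  have hsum : ∑ k, (Y k t - Z k t) - ∑ k, (Y k s - Z k s) - g ξ (x t - x s)
      = ∑ k, ((Y k t - Y k s - (c t - c s) • g ξ (e k))
        - (Z k t - Z k s - ((c t - x t k) - (c s - x s k)) • g ξ (e k))) := by
    rw [hxe, map_sum, ← Finset.sum_sub_distrib, ← Finset.sum_sub_distrib]
    refine Finset.sum_congr rfl fun k _ => ?_
    rw [map_smul]
    module
  simp only [hsum]
  calc _ ≤ ∑ k : Fin d, 3 * (ε / (3 * (d + 1))) * (c t - c s) := by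
        refine norm_sum_le_of_le _ fun k _ => (norm_sub_le _ _).trans ?_
        have a1 := H k s ξ t h0 h1 h2 h3 (hd.trans_le ((hη1 k).trans (min_le_left _ _)))
        have a2 := H' k s ξ t h0 h1 h2 h3 (hd.trans_le ((hη1 k).trans (min_le_right _ _)))
        have a3 := abs_le.1 (hcoord k s t (h1.trans h2))
        have a4 : ε / (3 * (d + 1)) * (c t - x t k - (c s - x s k))
            ≤ ε / (3 * (d + 1)) * (2 * (c t - c s)) := by
          gcongr; linarith
        linarith
    _ = (d / (d + 1)) * (ε * (c t - c s)) := by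
        rw [Finset.sum_const, Finset.card_univ, Fintype.card_fin, nsmul_eq_mul]
        field_simp
    _ ≤ 1 * (ε * (c t - c s)) := by
        gcongr
        rw [div_le_one (by positivity)]; linarith
    _ = _ := one_mul _

/-- The primitive constructed above has the same integrals, so by uniqueness of limits it differs
from `y` by a constant on `[0, T]`. -/
theorem isPrimitive_of_hasRSIntegral {d : ℕ} {W : Type*} [NormedAddCommGroup W] [NormedSpace ℝ W]
    [CompleteSpace W] {T : ℝ} {c : ℝ → ℝ} {g : ℝ → E d →L[ℝ] W} {x : ℝ → E d} {y : ℝ → W}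
    (hg : ContinuousOn g (Icc 0 T)) (hx : IsControl x c) (hxc : Continuous x)
    (h : ∀ t ∈ Icc 0 T, HasRSIntegral g x 0 t (y t - y 0)) : IsPrimitive T c g x y := by
  obtain ⟨Y, hY⟩ := exists_isPrimitive hg hx hxc
  refine (hY.add_const (y 0 - Y 0)).congr (fun _ _ => rfl) fun t ht => ?_
  have := HasRSIntegral.unique ht.1 (h t ht) (hY.hasRSIntegral hx.monotone ht)
  rw [sub_eq_iff_eq_add] at this
  rw [this]
  beta_reduce
  abel

/-! ### Paths in `𝒱¹` and their controls -/

section Paths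

variable {T : ℝ} [hT : Fact (0 < T)] {d : ℕ}

theorem continuous_onReal (y : C(Icc (0 : ℝ) T, E d)) : Continuous (onReal y) :=
  y.continuous.Icc_extend'

theorem onReal_of_mem (y : C(Icc (0 : ℝ) T, E d)) {t : ℝ} (ht : t ∈ Icc 0 T) :
    onReal y t = y ⟨t, ht⟩ :=
  IccExtend_of_mem _ _ ht

theorem onReal_eq_comp (y : C(Icc (0 : ℝ) T, E d)) : onReal y = y ∘ projIcc 0 T hT.out.le := rfl

theorem eq_of_eqOn_onReal {y y' : C(Icc (0 : ℝ) T, E d)}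
    (h : EqOn (onReal y) (onReal y') (Icc 0 T)) : y = y' := by
  ext1 t
  have := h t.2
  rwa [onReal_of_mem y t.2, onReal_of_mem y' t.2] at this

theorem exists_onReal_eqOn {y : ℝ → E d} (hy : ContinuousOn y (Icc 0 T)) :
    ∃ z : C(Icc (0 : ℝ) T, E d), EqOn y (onReal z) (Icc 0 T) :=
  ⟨⟨_, continuousOn_iff_continuous_domRestrict.1 hy⟩, fun t ht => by rw [onReal_of_mem _ ht]; rfl⟩

namespace V1

theorem eVariationOn_onReal_le (x : V1 T d) :
    eVariationOn (onReal x.toCont) univ ≤ eVariationOn x.toCont univ :=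
  eVariationOn.comp_le_of_monotoneOn _ _ ((monotone_projIcc _).monotoneOn _) (mapsTo_univ _ _)

theorem boundedVariationOn_onReal (x : V1 T d) : BoundedVariationOn (onReal x.toCont) univ :=
  ne_top_of_le_ne_top x.2 x.eVariationOn_onReal_le

theorem toReal_eVariationOn_onReal_le (x : V1 T d) :
    (eVariationOn (onReal x.toCont) univ).toReal ≤ ‖x‖ := by
  rw [norm_def]
  have h1 : _ ≤ (eVariationOn x.toCont univ).toReal :=
    ENNReal.toReal_mono x.2 x.eVariationOn_onReal_le
  have h2 : 0 ≤ ‖x.toCont‖ := norm_nonneg _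
  linarith

theorem norm_onReal_le (x : V1 T d) (t : ℝ) : ‖onReal x.toCont t‖ ≤ ‖x‖ := by
  rw [norm_def]
  have h1 := x.toCont.norm_coe_le_norm (projIcc 0 T hT.out.le t)
  have h2 : 0 ≤ (eVariationOn x.toCont univ).toReal := ENNReal.toReal_nonneg
  rw [onReal_eq_comp, Function.comp_apply]
  linarith

theorem onReal_sub (x x' : V1 T d) (t : ℝ) :
    onReal (x - x').toCont t = onReal x.toCont t - onReal x'.toCont t := rfl

/-- The variation of `x` up to time `t`. -/
noncomputable def control (x : V1 T d) : ℝ → ℝ := variationOnFromTo (onReal x.toCont) univ 0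

theorem control_zero (x : V1 T d) : x.control 0 = 0 := variationOnFromTo.self _ _ _

theorem isControl (x : V1 T d) : IsControl (onReal x.toCont) x.control := by
  have hl := x.boundedVariationOn_onReal.locallyBoundedVariationOn
  have hc := continuous_onReal x.toCont
  refine ⟨continuous_iff_continuousAt.2 fun t => ?_,
    monotoneOn_univ.1 (variationOnFromTo.monotoneOn hl (mem_univ _)), fun s t hst => ?_⟩
  -- The one-sided jumps of the variation function have the size of the jumps of the path, which
  -- vanish.
  · rw [continuousAt_iff_continuous_left'_right']
    constructor
    · have := variationOnFromTo.tendsto_left (a := 0) (b := t) (mem_univ _) (mem_univ _) hl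
        (hc.continuousAt.tendsto.mono_left nhdsWithin_le_nhds)
      simpa [ContinuousWithinAt, control] using this
    · have := variationOnFromTo.tendsto_right (a := 0) (b := t) (mem_univ _) (mem_univ _) hl
        (hc.continuousAt.tendsto.mono_left nhdsWithin_le_nhds)
      simpa [ContinuousWithinAt, control] using this
  · rw [control, ← variationOnFromTo.add hl (mem_univ 0) (mem_univ s) (mem_univ t),
      add_sub_cancel_left, variationOnFromTo.eq_of_le _ _ hst, ← dist_eq_norm, dist_comm]
    exact (x.boundedVariationOn_onReal.mono (subset_univ _)).dist_le
      ⟨mem_univ _, le_rfl, hst⟩ ⟨mem_univ _, hst, le_rfl⟩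

theorem control_le_norm (x : V1 T d) (t : ℝ) : x.control t ≤ ‖x‖ :=
  (le_abs_self _).trans ((variationOnFromTo.abs_le_eVariationOn x.boundedVariationOn_onReal).trans
    x.toReal_eVariationOn_onReal_le)

theorem control_nonneg (x : V1 T d) {t : ℝ} (ht : 0 ≤ t) : 0 ≤ x.control t :=
  variationOnFromTo.nonneg_of_le _ _ ht

theorem continuous_onReal_apply (t : ℝ) : Continuous fun x : V1 T d => onReal x.toCont t := by
  refine LipschitzWith.continuous (K := 1) (LipschitzWith.of_dist_le_mul fun x x' => ?_)
  rw [NNReal.coe_one, one_mul, dist_eq_norm, dist_eq_norm, ← onReal_sub]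
  exact norm_onReal_le _ _

end V1

end Paths

/-! ### Stability of controlled differential equations -/

section Stability

theorem isControl_zero_of_eq_zero {V : Type*} [NormedAddCommGroup V] {x : ℝ → V}
    (hx : ∀ t, x t = 0) : IsControl x (fun _ => 0) :=
  ⟨continuous_const, monotone_const, fun s t _ => by simp [hx]⟩

variable {V W : Type*} [NormedAddCommGroup V] [NormedSpace ℝ V] [NormedAddCommGroup W]
  [NormedSpace ℝ W]

/-- Gronwall applied to `g' dx' - g dx = (g' - g) dx' + g d(x' - x)`. The difference of the drivers
has its own control, so the bound is governed by its variation, as the norm of `𝒱¹` requires. -/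
theorem norm_sub_le_of_isPrimitive {T : ℝ} {c c' c'' : ℝ → ℝ} {g g' : ℝ → V →L[ℝ] W} {x x' : ℝ → V}
    {z z' : ℝ → W} (h : IsPrimitive T c g x z) (h' : IsPrimitive T c' g' x' z')
    (hx : IsControl x c) (hx' : IsControl x' c') (hxx : IsControl (fun t => x' t - x t) c'')
    {A L M : ℝ} (hA : 0 ≤ A) (hL : 0 ≤ L) (hM : 0 ≤ M)
    (hg : ∀ s ∈ Icc 0 T, ‖g s‖ ≤ M)
    (hgg : ∀ s ∈ Icc 0 T, ‖g' s - g s‖ ≤ A + L * ‖z' s - z s‖) {t : ℝ} (ht : t ∈ Icc 0 T) :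
    ‖z' t - z t‖ ≤ (‖z' 0 - z 0‖ + (A * (c' t - c' 0) + M * (c'' t - c'' 0)))
      * Real.exp (L * (c' t - c' 0)) := by
  have := gronwall_of_local (q := fun t => ‖z' t - z t‖) (a := fun t => A * c' t + M * c'' t)
    (b := fun t => c t + c' t) (c := c') ht.1 hL (fun _ => norm_nonneg _)
    ((hx'.monotone.const_mul hA).add (hxx.monotone.const_mul hM))
    (hx.monotone.add hx'.monotone) hx'.monotone ?_
  · refine this.trans_eq ?_
    ring_nf
  · intro ε hε
    obtain ⟨δ, hδ, H⟩ := h ε hε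
    obtain ⟨δ', hδ', H'⟩ := h' ε hε
    refine ⟨min δ δ', lt_min hδ hδ', fun s u hs hsu hu hd => ?_⟩
    have huT := hu.trans ht.2
    have e := H s s u hs le_rfl hsu huT (hd.trans_le (min_le_left _ _))
    have e' := H' s s u hs le_rfl hsu huT (hd.trans_le (min_le_right _ _))
    have hsT : s ∈ Icc 0 T := ⟨hs, hsu.trans huT⟩
    have e1 : z' u - z u = (z' s - z s) + ((z' u - z' s - g' s (x' u - x' s))
        - (z u - z s - g s (x u - x s))) + ((g' s - g s) (x' u - x' s)
        + g s ((x' u - x u) - (x' s - x s))) := by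
      simp only [_root_.sub_apply, map_sub]
      abel
    have e2 : ‖(g' s - g s) (x' u - x' s)‖ ≤ (A + L * ‖z' s - z s‖) * (c' u - c' s) :=
      ((g' s - g s).le_opNorm_of_le (hx'.norm_sub_le s u hsu)).trans (by
        have := sub_nonneg.2 (hx'.monotone hsu)
        gcongr
        exact hgg s hsT)
    have e3 : ‖g s ((x' u - x u) - (x' s - x s))‖ ≤ M * (c'' u - c'' s) :=
      ((g s).le_opNorm_of_le (hxx.norm_sub_le s u hsu)).trans (by
        have := sub_nonneg.2 (hxx.monotone hsu)
        gcongr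
        exact hg s hsT)
    have e4 := norm_add₃_le (a := z' s - z s) (b := (z' u - z' s - g' s (x' u - x' s))
        - (z u - z s - g s (x u - x s))) (c := (g' s - g s) (x' u - x' s)
        + g s ((x' u - x u) - (x' s - x s)))
    rw [← e1] at e4
    have e5 := norm_sub_le (z' u - z' s - g' s (x' u - x' s)) (z u - z s - g s (x u - x s))
    have e6 := norm_add_le ((g' s - g s) (x' u - x' s)) (g s ((x' u - x u) - (x' s - x s)))
    linarith

end Stability

/-! ### Existence and uniqueness of solutions -/

section Solutions

variable {T : ℝ} [hT : Fact (0 < T)] {dx dy : ℕ}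

theorem zero_mem_Icc : (0 : ℝ) ∈ Icc 0 T := ⟨le_rfl, hT.out.le⟩

theorem right_mem_Icc_of_fact : T ∈ Icc 0 T := ⟨hT.out.le, le_rfl⟩

theorem continuous_field_onReal (f : VectorField dx dy) (y : C(Icc (0 : ℝ) T, E dy)) :
    Continuous fun s => f (onReal y s) :=
  f.continuous.comp (continuous_onReal y)

theorem isCDESolution_iff {f : VectorField dx dy} {ζ : C(E dx, E dy)} {x : V1 T dx}
    {y : C(Icc (0 : ℝ) T, E dy)} :
    IsCDESolution f ζ x y ↔ onReal y 0 = ζ (onReal x.toCont 0) ∧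
      IsPrimitive T x.control (fun s => f (onReal y s)) (onReal x.toCont) (onReal y) := by
  refine and_congr_right fun _ => ⟨fun h => ?_, fun h t ht => ?_⟩
  · exact isPrimitive_of_hasRSIntegral (continuous_field_onReal f y).continuousOn x.isControl
      (continuous_onReal _) h
  · exact h.hasRSIntegral x.isControl.monotone ht

/-- Only the Lipschitz constant of `f` enters, and `f'` is compared with `f` only along `y'`. This
matters for perturbations, where the Lipschitz constants of the approximating fields are not
controlled. -/
theorem IsCDESolution.norm_sub_le {f f' : VectorField dx dy} {ζ ζ' : C(E dx, E dy)} {x : V1 T dx}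
    {y y' : C(Icc (0 : ℝ) T, E dy)} (h : IsCDESolution f ζ x y) (h' : IsCDESolution f' ζ' x y')
    {L : NNReal} (hf : LipschitzWith L f) {A : ℝ} (hA : 0 ≤ A)
    (hff : ∀ s ∈ Icc 0 T, ‖f' (onReal y' s) - f (onReal y' s)‖ ≤ A) {t : ℝ} (ht : t ∈ Icc 0 T) :
    ‖onReal y' t - onReal y t‖ ≤ (‖ζ' (onReal x.toCont 0) - ζ (onReal x.toCont 0)‖ + A * ‖x‖)
      * Real.exp (L * ‖x‖) := by
  obtain ⟨h0, hp⟩ := isCDESolution_iff.1 h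
  obtain ⟨h0', hp'⟩ := isCDESolution_iff.1 h'
  obtain ⟨M, hM⟩ := isCompact_Icc.exists_bound_of_continuousOn (s := Icc 0 T)
    (continuous_field_onReal f y).continuousOn
  have hM0 : 0 ≤ M := (norm_nonneg _).trans (hM 0 zero_mem_Icc)
  have := norm_sub_le_of_isPrimitive hp hp' x.isControl x.isControl
    (isControl_zero_of_eq_zero fun t => sub_self _) hA L.coe_nonneg hM0 hM (fun s hs => ?_) ht
  · rw [h0, h0', x.control_zero, sub_zero, sub_zero, mul_zero, add_zero] at this
    refine this.trans ?_
    have h1 := x.control_le_norm t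
    have h2 := x.control_nonneg ht.1
    gcongr
  · have e1 := hff s hs
    have e2 := hf.norm_sub_le (onReal y' s) (onReal y s)
    have e3 := norm_add_le (f' (onReal y' s) - f (onReal y' s)) (f (onReal y' s) - f (onReal y s))
    rw [sub_add_sub_cancel] at e3
    exact e3.trans (add_le_add e1 e2)

theorem IsCDESolution.unique {f : VectorField dx dy} {ζ : C(E dx, E dy)} {x : V1 T dx}
    {y y' : C(Icc (0 : ℝ) T, E dy)} (hf : f ∈ lipschitzFields dx dy) (h : IsCDESolution f ζ x y)
    (h' : IsCDESolution f ζ x y') : y' = y := by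
  obtain ⟨L, hL⟩ := hf
  refine eq_of_eqOn_onReal fun t ht => ?_
  have := h.norm_sub_le h' hL le_rfl (fun s _ => by simp) ht
  simp only [sub_self, norm_zero, zero_mul, add_zero] at this
  exact sub_eq_zero.1 (norm_le_zero_iff.1 this)

/-- Stability against the zero path, a primitive of the zero integrand, with `‖f y‖ ≤ ‖f 0‖ + L
‖y‖`. -/
theorem IsCDESolution.norm_le {f : VectorField dx dy} {ζ : C(E dx, E dy)} {x : V1 T dx}
    {y : C(Icc (0 : ℝ) T, E dy)} {L : NNReal} (hf : LipschitzWith L f) (h : IsCDESolution f ζ x y)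
    {t : ℝ} (ht : t ∈ Icc 0 T) :
    ‖onReal y t‖ ≤ (‖ζ (onReal x.toCont 0)‖ + ‖f 0‖ * ‖x‖) * Real.exp (L * ‖x‖) := by
  obtain ⟨h0, hp⟩ := isCDESolution_iff.1 h
  have := norm_sub_le_of_isPrimitive (IsPrimitive.const x.isControl.monotone (0 : E dy)) hp
    x.isControl x.isControl
    (isControl_zero_of_eq_zero fun t => sub_self _) (norm_nonneg (f 0)) L.coe_nonneg le_rfl (fun s hs => ?_)
    (fun s hs => ?_) ht
  · rw [h0, x.control_zero, sub_zero, sub_zero, sub_zero, zero_mul, add_zero] at this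
    refine this.trans ?_
    have h1 := x.control_le_norm t
    have h2 := x.control_nonneg ht.1
    gcongr
  · simp
  · have e2 := hf.norm_sub_le (onReal y s) 0
    have e3 := norm_add_le (f 0) (f (onReal y s) - f 0)
    simp only [add_sub_cancel, sub_zero] at e2 e3 ⊢
    exact e3.trans (add_le_add le_rfl e2)

theorem exists_isCDESolution {f : VectorField dx dy} (hf : f ∈ lipschitzFields dx dy)
    (ζ : C(E dx, E dy)) (x : V1 T dx) : ∃ y : C(Icc (0 : ℝ) T, E dy), IsCDESolution f ζ x y := by
  obtain ⟨L, hL⟩ := hf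
  set c := x.control with hc
  have hcx : IsControl (onReal x.toCont) c := x.isControl
  set y0 := ζ (onReal x.toCont 0)
  have hΦ : ∀ y : C(Icc (0 : ℝ) T, E dy), ∃ z : C(Icc (0 : ℝ) T, E dy), onReal z 0 = y0 ∧
      IsPrimitive T c (fun s => f (onReal y s)) (onReal x.toCont) (onReal z) := by
    intro y
    obtain ⟨Y, hY⟩ := exists_isPrimitive (T := T) (continuous_field_onReal f y).continuousOn hcx
      (continuous_onReal _)
    have hY' := hY.add_const (y0 - Y 0)
    obtain ⟨z, hz⟩ := exists_onReal_eqOn (hY'.continuousOn hcx)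
    refine ⟨z, ?_, hY'.congr (fun _ _ => rfl) hz⟩
    rw [← hz zero_mem_Icc]
    beta_reduce
    abel
  choose Φ hΦ0 hΦ using hΦ
  -- With this rate `L / l ≤ 1 / 2`, and `l > 0` even when `L = 0`.
  set l : ℝ := 2 * L + 1
  have hl : 0 < l := by positivity
  have hcc := hcx.continuous
  -- Conjugating the Picard map by the weight `exp (l * c t)` replaces an exponentially weighted
  -- norm; it contracts on all of `[0, T]` at once.
  let w : ℝ → C(Icc (0 : ℝ) T, E dy) → C(Icc (0 : ℝ) T, E dy) := fun r y =>
    ⟨fun t => Real.exp (r * c t) • y t, by fun_prop⟩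
  have hw : ∀ r y (t : Icc (0 : ℝ) T), w r y t = Real.exp (r * c t) • y t := fun _ _ _ => rfl
  have hcon : ContractingWith (1 / 2) fun y => w (-l) (Φ (w l y)) := by
    refine ⟨by norm_num [← NNReal.coe_lt_coe], LipschitzWith.of_dist_le_mul fun y y' => ?_⟩
    rw [ContinuousMap.dist_le (by positivity)]
    intro t
    have hp := (hΦ (w l y)).sub hcx.monotone (hΦ (w l y'))
    set D := dist y y'
    have hD : 0 ≤ D := dist_nonneg
    have := hp.norm_sub_le_of_norm_le hcx (a := fun t => L * D / l * Real.exp (l * c t))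
      (fun s u hs hsu hu => ?_) t.2.1 t.2.2
    · simp only [hΦ0, sub_self, sub_zero] at this
      rw [onReal_of_mem _ t.2, onReal_of_mem _ t.2] at this
      rw [hw, hw, dist_eq_norm, ← smul_sub, norm_smul, Real.norm_eq_abs, Real.abs_exp]
      calc _ ≤ Real.exp (-l * c t) * (L * D / l * Real.exp (l * c t)) := by
            gcongr
            refine this.trans (sub_le_self _ (by positivity))
        _ = L / l * D * (Real.exp (-l * c t) * Real.exp (l * c t)) := by ring
        _ = L / l * D := by rw [← Real.exp_add]; simp
        _ ≤ _ := by
            gcongr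
            rw [div_le_iff₀ hl]
            push_cast
            simp only [l]
            linarith
    · have hsT : s ∈ Icc 0 T := ⟨hs, hsu.trans hu⟩
      have e1 := hL.norm_sub_le (onReal (w l y) s) (onReal (w l y') s)
      rw [onReal_of_mem _ hsT, onReal_of_mem _ hsT, hw, hw, ← smul_sub, norm_smul,
        Real.norm_eq_abs, Real.abs_exp, ← dist_eq_norm (y _)] at e1
      have e2 : dist (y ⟨s, hsT⟩) (y' ⟨s, hsT⟩) ≤ D := ContinuousMap.dist_apply_le_dist _
      have e3 : 0 ≤ c u - c s := sub_nonneg.2 (hcx.monotone hsu)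
      have e4 : Real.exp (l * c s) * (1 + l * (c u - c s)) ≤ Real.exp (l * c u) := by
        have : Real.exp (l * c u) = Real.exp (l * c s) * Real.exp (l * (c u - c s)) := by
          rw [← Real.exp_add]; ring_nf
        rw [this]
        gcongr
        linarith [Real.add_one_le_exp (l * (c u - c s))]
      rw [onReal_of_mem _ hsT, onReal_of_mem _ hsT, hw, hw]
      calc _ ≤ L * (Real.exp (l * c s) * D) * (c u - c s) := by
            gcongr
            refine e1.trans ?_
            gcongr
        _ = L * D / l * (Real.exp (l * c s) * (1 + l * (c u - c s)) - Real.exp (l * c s)) := by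
            field_simp
            ring
        _ ≤ L * D / l * (Real.exp (l * c u) - Real.exp (l * c s)) := by gcongr
        _ = _ := by ring
  obtain ⟨y, hy⟩ : ∃ y, Function.IsFixedPt (fun y => w (-l) (Φ (w l y))) y :=
    ⟨_, hcon.fixedPoint_isFixedPt⟩
  have hy' : Φ (w l y) = w l y := by
    ext1 t
    have h1 : w (-l) (Φ (w l y)) t = y t := congrArg (fun g : C(Icc (0 : ℝ) T, E dy) => g t) hy
    rw [hw] at h1
    rw [hw, ← h1, smul_smul, ← Real.exp_add]
    simp
  refine ⟨w l y, isCDESolution_iff.2 ⟨?_, ?_⟩⟩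
  · rw [← hy']; exact hΦ0 _
  · have := hΦ (w l y)
    rwa [hy'] at this

/-- The field is bounded along the fixed solution `z x` only, so Gronwall's bound is a continuous
function of `x'` that vanishes at `x' = x`. -/
theorem exists_continuous_isReadout {m : ℕ} {f : VectorField dx dy}
    (hf : f ∈ lipschitzFields dx dy) (ζ : C(E dx, E dy)) (ℓ : E dy →ₗ[ℝ] E m) :
    ∃ g : C(V1 T dx, E m), ∀ x, IsReadout f ζ ℓ x (g x) := by
  choose z hz using fun x : V1 T dx => exists_isCDESolution hf ζ x
  have hcont : Continuous fun x => onReal (z x) T := by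
    obtain ⟨L, hL⟩ := hf
    rw [continuous_iff_continuousAt]
    intro x
    obtain ⟨h0, hp⟩ := isCDESolution_iff.1 (hz x)
    obtain ⟨M, hM⟩ := isCompact_Icc.exists_bound_of_continuousOn (s := Icc 0 T)
      (continuous_field_onReal f (z x)).continuousOn
    have hM0 : 0 ≤ M := (norm_nonneg _).trans (hM 0 zero_mem_Icc)
    have key : ∀ x' : V1 T dx, ‖onReal (z x') T - onReal (z x) T‖
        ≤ (‖ζ (onReal x'.toCont 0) - ζ (onReal x.toCont 0)‖ + M * ‖x' - x‖)
          * Real.exp (L * ‖x'‖) := by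
      intro x'
      obtain ⟨h0', hp'⟩ := isCDESolution_iff.1 (hz x')
      have := norm_sub_le_of_isPrimitive hp hp' x.isControl x'.isControl
        (x' - x).isControl le_rfl L.coe_nonneg hM0 hM (fun s hs => ?_) (t := T) right_mem_Icc_of_fact
      · rw [h0, h0', V1.control_zero, V1.control_zero, sub_zero, sub_zero, zero_mul,
          zero_add] at this
        refine this.trans ?_
        have h1 := x'.control_le_norm T
        have h2 := (x' - x).control_le_norm T
        have h3 := x'.control_nonneg hT.out.le
        gcongr
      · rw [zero_add]
        exact hL.norm_sub_le _ _
    rw [ContinuousAt, tendsto_iff_norm_sub_tendsto_zero]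
    refine squeeze_zero (fun _ => norm_nonneg _) key ?_
    have hc : Continuous fun x' : V1 T dx =>
        (‖ζ (onReal x'.toCont 0) - ζ (onReal x.toCont 0)‖ + M * ‖x' - x‖)
          * Real.exp (L * ‖x'‖) := by
      have := V1.continuous_onReal_apply (T := T) (d := dx) 0
      fun_prop
    simpa using hc.tendsto x
  exact ⟨⟨fun x => ℓ (onReal (z x) T), ℓ.continuous_of_finiteDimensional.comp hcont⟩,
    fun x => ⟨z x, hz x, fun z' hz' => (hz x).unique hf hz', rfl⟩⟩

theorem IsReadout.unique {m : ℕ} {f : VectorField dx dy} {ζ : C(E dx, E dy)}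
    {ℓ : E dy →ₗ[ℝ] E m} {x : V1 T dx} {v v' : E m} (h : IsReadout f ζ ℓ x v)
    (h' : IsReadout f ζ ℓ x v') : v = v' := by
  obtain ⟨z, hz, hu, rfl⟩ := h
  obtain ⟨z', hz', -, rfl⟩ := h'
  rw [hu z' hz']

end Solutions

/-! ### Rules for primitives -/

section Rules

variable {V W : Type*} [NormedAddCommGroup V] [NormedSpace ℝ V] [NormedAddCommGroup W]
  [NormedSpace ℝ W] {T : ℝ} {c : ℝ → ℝ} {x : ℝ → V}

theorem IsPrimitive.sum {ι : Type*} (s : Finset ι) (hc : Monotone c) {g : ι → ℝ → V →L[ℝ] W}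
    {y : ι → ℝ → W} (h : ∀ i ∈ s, IsPrimitive T c (g i) x (y i)) :
    IsPrimitive T c (fun t => ∑ i ∈ s, g i t) x (fun t => ∑ i ∈ s, y i t) := by
  classical
  induction s using Finset.induction_on with
  | empty => simpa using IsPrimitive.const (x := x) (V := V) (W := W) hc 0
  | insert a s ha ih =>
    simp only [Finset.sum_insert ha]
    exact (h a (Finset.mem_insert_self a s)).add
      (ih fun i hi => h i (Finset.mem_insert_of_mem hi))

theorem isPrimitive_of_forall_coord {n : ℕ} (hc : Monotone c) {g : ℝ → V →L[ℝ] E n} {y : ℝ → E n}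
    (h : ∀ a, IsPrimitive T c (fun s => (EuclideanSpace.proj a).comp (g s)) x (fun s => y s a)) :
    IsPrimitive T c g x y := by
  have hsum := IsPrimitive.sum Finset.univ hc fun a _ =>
    (h a).clm_comp ((1 : ℝ →L[ℝ] ℝ).smulRight (EuclideanSpace.single a (1 : ℝ))) hc
  refine hsum.congr (fun s _ => ?_) fun s _ => ?_
  · ext v a
    simp [Finset.sum_apply, Pi.single_apply]
  · ext a
    simp [Finset.sum_apply, Pi.single_apply]

/-- Leibniz rule: in `v t * (u t - u s) + u s * (v t - v s)`, uniform continuity moves `v t` and `u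
s` to the tag. Four errors result, each at most `ε / 4` times the increment of `c`. -/
theorem IsPrimitive.mul {g h : ℝ → V →L[ℝ] ℝ} {u v : ℝ → ℝ} (hx : IsControl x c)
    (hg : ContinuousOn g (Icc 0 T)) (hh : ContinuousOn h (Icc 0 T))
    (hu : IsPrimitive T c g x u) (hv : IsPrimitive T c h x v) :
    IsPrimitive T c (fun s => v s • g s + u s • h s) x (fun s => u s * v s) := by
  obtain ⟨Mg, hMg⟩ := isCompact_Icc.exists_bound_of_continuousOn hg
  obtain ⟨Mh, hMh⟩ := isCompact_Icc.exists_bound_of_continuousOn hh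
  have huc := hu.continuousOn hx
  have hvc := hv.continuousOn hx
  obtain ⟨Mu, hMu⟩ := isCompact_Icc.exists_bound_of_continuousOn huc
  obtain ⟨Mv, hMv⟩ := isCompact_Icc.exists_bound_of_continuousOn hvc
  have huu := isCompact_Icc.uniformContinuousOn_of_continuous huc
  have hvu := isCompact_Icc.uniformContinuousOn_of_continuous hvc
  rw [Metric.uniformContinuousOn_iff] at huu hvu
  set M := |Mg| + |Mh| + |Mu| + |Mv| + 1
  have a1 := abs_nonneg Mg
  have a2 := abs_nonneg Mh
  have a3 := abs_nonneg Mu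
  have a4 := abs_nonneg Mv
  have hM : 0 < M := by positivity
  intro ε hε
  have hε' : 0 < ε / (4 * M) := by positivity
  obtain ⟨δ1, hδ1, H1⟩ := hu _ hε'
  obtain ⟨δ2, hδ2, H2⟩ := hv _ hε'
  obtain ⟨δ3, hδ3, H3⟩ := huu _ hε'
  obtain ⟨δ4, hδ4, H4⟩ := hvu _ hε'
  refine ⟨min (min δ1 δ2) (min δ3 δ4), lt_min (lt_min hδ1 hδ2) (lt_min hδ3 hδ4),
    fun s ξ t h0 h1 h2 h3 hd => ?_⟩
  rw [lt_min_iff, lt_min_iff, lt_min_iff] at hd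
  have hs : s ∈ Icc 0 T := ⟨h0, h1.trans (h2.trans h3)⟩
  have ht : t ∈ Icc 0 T := ⟨h0.trans (h1.trans h2), h3⟩
  have hξ : ξ ∈ Icc 0 T := ⟨h0.trans h1, h2.trans h3⟩
  have e1 := H1 s ξ t h0 h1 h2 h3 hd.1.1
  have e2 := H2 s ξ t h0 h1 h2 h3 hd.1.2
  have e3 : ‖u s - u ξ‖ ≤ ε / (4 * M) := by
    rw [← dist_eq_norm]
    refine (H3 s hs ξ hξ ?_).le
    rw [Real.dist_eq, abs_sub_comm, abs_of_nonneg (by linarith)]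
    linarith [hd.2.1]
  have e4 : ‖v t - v ξ‖ ≤ ε / (4 * M) := by
    rw [← dist_eq_norm]
    refine (H4 t ht ξ hξ ?_).le
    rw [Real.dist_eq, abs_of_nonneg (by linarith)]
    linarith [hd.2.2]
  have hC : 0 ≤ c t - c s := sub_nonneg.2 (hx.monotone (h1.trans h2))
  have f1 : ‖g ξ (x t - x s)‖ ≤ M * (c t - c s) :=
    ((g ξ).le_opNorm_of_le (hx.norm_sub_le s t (h1.trans h2))).trans (by
      gcongr
      linarith [hMg ξ hξ, le_abs_self Mg])
  have f2 : ‖h ξ (x t - x s)‖ ≤ M * (c t - c s) :=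
    ((h ξ).le_opNorm_of_le (hx.norm_sub_le s t (h1.trans h2))).trans (by
      gcongr
      linarith [hMh ξ hξ, le_abs_self Mh])
  have f3 : ‖v t‖ ≤ M := by linarith [hMv t ht, le_abs_self Mv]
  have f4 : ‖u s‖ ≤ M := by linarith [hMu s hs, le_abs_self Mu]
  have id1 : u t * v t - u s * v s - (v ξ • g ξ + u ξ • h ξ) (x t - x s)
      = v t * (u t - u s - g ξ (x t - x s)) + u s * (v t - v s - h ξ (x t - x s))
        + ((v t - v ξ) * g ξ (x t - x s) + (u s - u ξ) * h ξ (x t - x s)) := by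
    simp only [_root_.add_apply, _root_.smul_apply, smul_eq_mul]
    ring
  have key : ε / (4 * M) * M = ε / 4 := by field_simp
  have b1 : ‖v t * (u t - u s - g ξ (x t - x s))‖ ≤ ε / 4 * (c t - c s) := by
    rw [norm_mul, ← key, mul_comm (ε / (4 * M)) M, mul_assoc]
    gcongr
  have b2 : ‖u s * (v t - v s - h ξ (x t - x s))‖ ≤ ε / 4 * (c t - c s) := by
    rw [norm_mul, ← key, mul_comm (ε / (4 * M)) M, mul_assoc]
    gcongr
  have b3 : ‖(v t - v ξ) * g ξ (x t - x s)‖ ≤ ε / 4 * (c t - c s) := by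
    rw [norm_mul, ← key, mul_assoc]
    gcongr
  have b4 : ‖(u s - u ξ) * h ξ (x t - x s)‖ ≤ ε / 4 * (c t - c s) := by
    rw [norm_mul, ← key, mul_assoc]
    gcongr
  beta_reduce
  rw [id1]
  have n1 := norm_add₃_le (a := v t * (u t - u s - g ξ (x t - x s)))
    (b := u s * (v t - v s - h ξ (x t - x s)))
    (c := (v t - v ξ) * g ξ (x t - x s) + (u s - u ξ) * h ξ (x t - x s))
  have n2 := norm_add_le ((v t - v ξ) * g ξ (x t - x s)) ((u s - u ξ) * h ξ (x t - x s))
  linarith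

end Rules

/-! ### Linear systems -/

section Linear

variable {T : ℝ} {c : ℝ → ℝ} {d : ℕ} {x : ℝ → E d}

/-- `y` solves the linear system `dy_i = ∑_j y_j A_{ij} dx`. -/
def IsLinearSolution {ι : Type*} [Fintype ι] (T : ℝ) (c : ℝ → ℝ) (x : ℝ → E d)
    (A : Matrix ι ι (E d →L[ℝ] ℝ)) (y : ι → ℝ → ℝ) : Prop :=
  ∀ i, IsPrimitive T c (fun s => ∑ j, y j s • A i j) x (y i)

theorem IsLinearSolution.continuousOn {ι : Type*} [Fintype ι] {A : Matrix ι ι (E d →L[ℝ] ℝ)}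
    {y : ι → ℝ → ℝ} (h : IsLinearSolution T c x A y) (hx : IsControl x c) (i : ι) :
    ContinuousOn (y i) (Icc 0 T) :=
  (h i).continuousOn hx

theorem IsLinearSolution.continuousOn_sum {ι : Type*} [Fintype ι] {A : Matrix ι ι (E d →L[ℝ] ℝ)}
    {y : ι → ℝ → ℝ} (h : IsLinearSolution T c x A y) (hx : IsControl x c) (i : ι) :
    ContinuousOn (fun s => ∑ j, y j s • A i j) (Icc 0 T) :=
  continuousOn_finsetSum _ fun j _ => (h.continuousOn hx j).smul continuousOn_const

open Classical in
/-- The matrix of the linear system that is solved by the products of the solutions of two linear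
systems. -/
noncomputable def productMatrix {ι κ : Type*} (A : Matrix ι ι (E d →L[ℝ] ℝ))
    (B : Matrix κ κ (E d →L[ℝ] ℝ)) : Matrix (ι × κ) (ι × κ) (E d →L[ℝ] ℝ) := fun p q =>
  (if p.2 = q.2 then A p.1 q.1 else 0) + (if p.1 = q.1 then B p.2 q.2 else 0)

/-- The product rule turns each `d(y_i z_k)` into a linear combination of products, with the
Kronecker sum of `A` and `B` as its matrix. -/
theorem IsLinearSolution.mul {ι κ : Type*} [Fintype ι] [Fintype κ] {A : Matrix ι ι (E d →L[ℝ] ℝ)}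
    {B : Matrix κ κ (E d →L[ℝ] ℝ)} {y : ι → ℝ → ℝ} {z : κ → ℝ → ℝ} (hx : IsControl x c)
    (hy : IsLinearSolution T c x A y) (hz : IsLinearSolution T c x B z) :
    IsLinearSolution T c x (productMatrix A B) (fun p s => y p.1 s * z p.2 s) := by
  classical
  rintro ⟨i, k⟩
  refine ((hy i).mul hx (hy.continuousOn_sum hx i) (hz.continuousOn_sum hx k) (hz k)).congr
    (fun s _ => ?_) fun _ _ => rfl
  simp only [productMatrix, Fintype.sum_prod_type, smul_add, Finset.sum_add_distrib, smul_ite, smul_zero]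
  rw [Finset.smul_sum, Finset.smul_sum]
  congr 1
  · simp [smul_smul, mul_comm]
  · rw [Finset.sum_comm]
    simp [smul_smul]

theorem IsLinearSolution.sum {ι κ : Type*} [Fintype ι] [Fintype κ] {A : Matrix ι ι (E d →L[ℝ] ℝ)}
    {B : Matrix κ κ (E d →L[ℝ] ℝ)} {y : ι → ℝ → ℝ} {z : κ → ℝ → ℝ}
    (hy : IsLinearSolution T c x A y) (hz : IsLinearSolution T c x B z) :
    IsLinearSolution T c x (Matrix.fromBlocks A 0 0 B) (Sum.elim y z) := by
  rintro (i | k)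
  · simpa using hy i
  · simpa using hz k

theorem IsLinearSolution.sigma {n : ℕ} {ι : Fin n → Type*} [∀ k, Fintype (ι k)]
    {A : ∀ k, Matrix (ι k) (ι k) (E d →L[ℝ] ℝ)} {y : ∀ k, ι k → ℝ → ℝ}
    (hy : ∀ k, IsLinearSolution T c x (A k) (y k)) :
    IsLinearSolution T c x (Matrix.blockDiagonal' A) (fun p : Σ k, ι k => y p.1 p.2) := by
  rintro ⟨k, i⟩
  refine (hy k i).congr (fun s _ => ?_) fun _ _ => rfl
  rw [Fintype.sum_sigma, Finset.sum_eq_single k]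
  · simp [Matrix.blockDiagonal'_apply_eq]
  · intro k' _ hk'
    simp [Matrix.blockDiagonal'_apply_ne _ _ _ hk'.symm]
  · simp

/-- The matrix of a linear system, enlarged by a new variable that no derivative depends on. -/
def optionMatrix {ι : Type*} (A : Matrix ι ι (E d →L[ℝ] ℝ)) (a : ι → E d →L[ℝ] ℝ) :
    Matrix (Option ι) (Option ι) (E d →L[ℝ] ℝ) :=
  fun p q => q.elim 0 fun j => p.elim (a j) fun i => A i j

theorem IsLinearSolution.option {ι : Type*} [Fintype ι] {A : Matrix ι ι (E d →L[ℝ] ℝ)}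
    {y : ι → ℝ → ℝ} (hy : IsLinearSolution T c x A y) {a : ι → E d →L[ℝ] ℝ} {z : ℝ → ℝ}
    (hz : IsPrimitive T c (fun s => ∑ j, y j s • a j) x z) :
    IsLinearSolution T c x (optionMatrix A a) (fun p : Option ι => p.elim z y) := by
  rintro (_ | i)
  · simpa [optionMatrix, Fintype.sum_option] using hz
  · simpa [optionMatrix, Fintype.sum_option] using hy i

/-! ### Iterated integrals as solutions of linear systems -/

/-- Continuity at one level makes the integral at the next level exist, so the default value of
`rsIntegral` is never taken; the induction therefore carries both facts. -/
theorem iteratedIntegral_props (hx : IsControl x c) (hxc : Continuous x) (w : List (Fin d)) :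
    ContinuousOn (iteratedIntegral x w) (Icc 0 T) ∧
    ∀ k, (0 ≤ T → iteratedIntegral x (k :: w) 0 = 0) ∧
      IsPrimitive T c (fun s => iteratedIntegral x w s • EuclideanSpace.proj k) x
        (iteratedIntegral x (k :: w)) := by
  have step : ∀ w : List (Fin d), ContinuousOn (iteratedIntegral x w) (Icc 0 T) →
      ∀ k, (0 ≤ T → iteratedIntegral x (k :: w) 0 = 0) ∧
      IsPrimitive T c (fun s => iteratedIntegral x w s • EuclideanSpace.proj k) x
        (iteratedIntegral x (k :: w)) := by
    intro w hw k
    have hg : ContinuousOn (fun s => iteratedIntegral x w s •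
        (EuclideanSpace.proj k : E d →L[ℝ] ℝ)) (Icc 0 T) := hw.smul continuousOn_const
    obtain ⟨Y, hY⟩ := exists_isPrimitive hg hx hxc
    have hrs : ∀ t ∈ Icc 0 T, iteratedIntegral x (k :: w) t = Y t - Y 0 := by
      intro t ht
      have h1 : HasRSIntegral (fun s => ContinuousLinearMap.mul ℝ ℝ (iteratedIntegral x w s))
          (fun s => x s k) 0 t (Y t - Y 0) := by
        simpa [HasRSIntegral] using hY.hasRSIntegral hx.monotone ht
      have hex : ∃ I, HasRSIntegral (fun s => ContinuousLinearMap.mul ℝ ℝ (iteratedIntegral x w s))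
          (fun s => x s k) 0 t I := ⟨_, h1⟩
      change rsIntegral (iteratedIntegral x w) (fun s => x s k) 0 t = _
      unfold rsIntegral
      rw [dif_pos hex]
      exact hex.choose_spec.unique ht.1 h1
    refine ⟨fun hT => by rw [hrs 0 ⟨le_rfl, hT⟩, sub_self], ?_⟩
    refine (hY.add_const (-Y 0)).congr (fun _ _ => rfl) fun t ht => ?_
    rw [hrs t ht, sub_eq_add_neg]
  have hcont : ContinuousOn (iteratedIntegral x w) (Icc 0 T) := by
    induction w with
    | nil => exact continuousOn_const
    | cons k w ih => exact (step w ih k).2.continuousOn hx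
  exact ⟨hcont, step w hcont⟩

/-- The iterated integrals of all paths along a given word solve one and the same linear system. -/
theorem exists_isLinearSolution_iteratedIntegral (hT : 0 ≤ T) (w : List (Fin d)) :
    ∃ (ι : Type) (_ : Fintype ι) (A : Matrix ι ι (E d →L[ℝ] ℝ)) (y0 : ι → ℝ) (i0 : ι),
      ∀ (x : ℝ → E d) (c : ℝ → ℝ), IsControl x c → Continuous x →
        ∃ y : ι → ℝ → ℝ, (∀ i, y i 0 = y0 i) ∧ IsLinearSolution T c x A y ∧
          y i0 = iteratedIntegral x w := by
  classical
  induction w with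
  | nil =>
    refine ⟨Unit, inferInstance, 0, fun _ => 1, (), fun x c hx _ => ⟨fun _ _ => 1, fun _ => rfl,
      fun _ => ?_, rfl⟩⟩
    simpa using IsPrimitive.const (x := x) (W := ℝ) hx.monotone 1
  | cons k w ih =>
    obtain ⟨ι, _, A, y0, i0, H⟩ := ih
    -- The new variable is the outer integral: it is driven by the variable `i0` alone, through
    -- coordinate `k` of the path, and starts at `0`.
    refine ⟨Option ι, inferInstance,
      optionMatrix A fun j => if j = i0 then EuclideanSpace.proj k else 0, fun p => p.elim 0 y0, none, fun x c hx hxc => ?_⟩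
    obtain ⟨y, hy0, hy, hyw⟩ := H x c hx hxc
    obtain ⟨-, hw⟩ := iteratedIntegral_props (T := T) hx hxc w
    refine ⟨fun p => p.elim (iteratedIntegral x (k :: w)) y, ?_,
      hy.option ?_, rfl⟩
    · rintro (_ | i)
      · exact (hw k).1 hT
      · exact hy0 i
    · simpa [hyw] using (hw k).2

end Linear

/-! ### Readouts of linear systems -/

section LinearReadout

variable {T : ℝ} [hT : Fact (0 < T)] {d : ℕ} {U : Type*}

/-- `g(u)` is a linear functional of the terminal value of a linear system driven by `p(u)`, with
initial values that depend continuously on `p(u)(0)`. -/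
def IsLinearReadout (p : U → V1 T d) (g : U → ℝ) : Prop :=
  ∃ (ι : Type) (_ : Fintype ι) (A : Matrix ι ι (E d →L[ℝ] ℝ)) (ζ : ι → C(E d, ℝ)) (ℓ : ι → ℝ),
    ∀ u, ∃ y : ι → ℝ → ℝ, (∀ i, y i 0 = ζ i (onReal (p u).toCont 0)) ∧
      IsLinearSolution T (p u).control (onReal (p u).toCont) A y ∧ g u = ∑ i, ℓ i * y i T

variable {p : U → V1 T d}

theorem isLinearReadout_initial (ζ : C(E d, ℝ)) :
    IsLinearReadout p fun u => ζ (onReal (p u).toCont 0) := by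
  refine ⟨Unit, inferInstance, 0, fun _ => ζ, fun _ => 1, fun u =>
    ⟨fun _ _ => ζ (onReal (p u).toCont 0), fun _ => rfl, fun _ => ?_, by simp⟩⟩
  simpa using IsPrimitive.const (p u).isControl.monotone (ζ (onReal (p u).toCont 0))

theorem isLinearReadout_iteratedIntegral (w : List (Fin d)) :
    IsLinearReadout p fun u => iteratedIntegral (onReal (p u).toCont) w T := by
  classical
  obtain ⟨ι, _, A, y0, i0, H⟩ := exists_isLinearSolution_iteratedIntegral hT.out.le w
  refine ⟨ι, inferInstance, A, fun i => ContinuousMap.const _ (y0 i), Pi.single i0 1, fun u => ?_⟩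
  obtain ⟨y, hy0, hy, hyw⟩ := H _ _ (p u).isControl (continuous_onReal _)
  exact ⟨y, hy0, hy, by simp [Pi.single_apply, hyw]⟩

theorem IsLinearReadout.add {g h : U → ℝ} (hg : IsLinearReadout p g) (hh : IsLinearReadout p h) :
    IsLinearReadout p fun u => g u + h u := by
  obtain ⟨ι, _, A, ζ, ℓ, H⟩ := hg
  obtain ⟨κ, _, A', ζ', ℓ', H'⟩ := hh
  refine ⟨ι ⊕ κ, inferInstance, Matrix.fromBlocks A 0 0 A', Sum.elim ζ ζ', Sum.elim ℓ ℓ',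
    fun u => ?_⟩
  obtain ⟨y, hy0, hy, hg⟩ := H u
  obtain ⟨z, hz0, hz, hh⟩ := H' u
  refine ⟨Sum.elim y z, ?_, hy.sum hz, by simp [hg, hh]⟩
  rintro (i | k)
  exacts [hy0 i, hz0 k]

theorem IsLinearReadout.mul {g h : U → ℝ} (hg : IsLinearReadout p g) (hh : IsLinearReadout p h) :
    IsLinearReadout p fun u => g u * h u := by
  obtain ⟨ι, _, A, ζ, ℓ, H⟩ := hg
  obtain ⟨κ, _, A', ζ', ℓ', H'⟩ := hh
  refine ⟨ι × κ, inferInstance, productMatrix A A', fun q => ζ q.1 * ζ' q.2, fun q => ℓ q.1 * ℓ' q.2, fun u => ?_⟩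
  obtain ⟨y, hy0, hy, hg⟩ := H u
  obtain ⟨z, hz0, hz, hh⟩ := H' u
  refine ⟨_, ?_, hy.mul (p u).isControl hz, ?_⟩
  · rintro ⟨i, k⟩
    simp [hy0, hz0]
  · beta_reduce
    rw [hg, hh, Fintype.sum_mul_sum, Fintype.sum_prod_type]
    refine Finset.sum_congr rfl fun i _ => Finset.sum_congr rfl fun k _ => ?_
    ring

/-- The linear vector field on `ℝ^n` with matrix `A`, which takes values in the linear forms. -/
noncomputable def linearField {n : ℕ} (A : Matrix (Fin n) (Fin n) (E d →L[ℝ] ℝ)) :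
    E n →L[ℝ] E d →L[ℝ] E n :=
  ∑ i, ∑ j, (EuclideanSpace.proj j : E n →L[ℝ] ℝ).smulRight
    ((A i j).smulRight (EuclideanSpace.single i (1 : ℝ)))

theorem linearField_apply {n : ℕ} (A : Matrix (Fin n) (Fin n) (E d →L[ℝ] ℝ)) (y : E n) (v : E d)
    (i : Fin n) : linearField A y v i = ∑ j, y j * A i j v := by
  simp [linearField, Finset.sum_apply, Pi.single_apply]

theorem exists_isReadout_of_isLinearReadout {m : ℕ} {g : Fin m → U → ℝ}
    (hg : ∀ k, IsLinearReadout p (g k)) :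
    ∃ n : ℕ, 1 ≤ n ∧ ∃ f ∈ lipschitzFields d n, ∃ (ζ : C(E d, E n)) (ℓ : E n →ₗ[ℝ] E m),
      ∀ u, IsReadout f ζ ℓ (p u) (WithLp.toLp 2 fun k => g k u) := by
  classical
  choose ι hι A ζ ℓ H using hg
  -- The extra variable is identically zero; it keeps the dimension positive when all the systems
  -- are empty, for instance for `m = 0`.
  let J := Option (Σ k, ι k)
  let e : J ≃ Fin (Fintype.card J) := Fintype.equivFin J
  let B : Matrix J J (E d →L[ℝ] ℝ) := optionMatrix (Matrix.blockDiagonal' A) 0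
  let f := linearField fun a b => B (e.symm a) (e.symm b)
  have hf : (f : VectorField d (Fintype.card J)) ∈ lipschitzFields d _ := ⟨_, f.lipschitz⟩
  let ζJ : J → C(E d, ℝ) := fun q => q.elim 0 fun r => ζ r.1 r.2
  let Z : C(E d, E (Fintype.card J)) :=
    ⟨fun v => WithLp.toLp 2 fun a => ζJ (e.symm a) v, by fun_prop⟩
  let R : E (Fintype.card J) →ₗ[ℝ] E m :=
    { toFun := fun y => WithLp.toLp 2 fun k => ∑ i, ℓ k i * y (e (some ⟨k, i⟩))
      map_add' := fun y z => by
        ext k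
        simp [mul_add, Finset.sum_add_distrib]
      map_smul' := fun r y => by
        ext k
        simp only [PiLp.smul_apply, smul_eq_mul, RingHom.id_apply, Finset.mul_sum]
        exact Finset.sum_congr rfl fun i _ => by ring }
  refine ⟨Fintype.card J, Fintype.card_pos, f, hf, Z, R, fun u => ?_⟩
  choose y hy0 hy hgy using fun k => H k u
  have hc := (p u).isControl
  have hsol : IsLinearSolution T (p u).control (onReal (p u).toCont) B
      (fun q : J => q.elim (fun _ => 0) fun r => y r.1 r.2) :=
    (IsLinearSolution.sigma hy).option (a := 0)
      (by simpa using IsPrimitive.const (x := onReal (p u).toCont) (W := ℝ) hc.monotone 0)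
  set yJ : J → ℝ → ℝ := fun q => q.elim (fun _ => 0) fun r => y r.1 r.2 with hyJ
  let Y : ℝ → E (Fintype.card J) := fun t => WithLp.toLp 2 fun a => yJ (e.symm a) t
  have hY : IsPrimitive T (p u).control (fun s => f (Y s)) (onReal (p u).toCont) Y := by
    refine isPrimitive_of_forall_coord hc.monotone fun a => ?_
    refine (hsol (e.symm a)).congr (fun s _ => ?_) fun _ _ => rfl
    ext v
    refine Eq.trans ?_ (linearField_apply _ (Y s) v a).symm
    beta_reduce
    rw [← Equiv.sum_comp e.symm]
    simp [Y]
  obtain ⟨z, hz⟩ := exists_onReal_eqOn (hY.continuousOn hc)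
  have hzs : IsCDESolution (f : VectorField d (Fintype.card J)) Z (p u) z := by
    refine isCDESolution_iff.2 ⟨?_, hY.congr (fun s hs => ?_) hz⟩
    · rw [← hz zero_mem_Icc]
      ext a
      change yJ (e.symm a) 0 = ζJ (e.symm a) _
      rcases e.symm a with _ | ⟨k, i⟩
      · rfl
      · exact hy0 k i
    · change f (Y s) = f (onReal z s)
      rw [hz hs]
  refine ⟨z, hzs, fun z' hz' => hzs.unique hf hz', ?_⟩
  rw [← hz right_mem_Icc_of_fact]
  ext k
  simp [R, Y, hyJ, hgy]

/-! ### Density of the readouts of linear systems -/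

variable [TopologicalSpace U]

theorem IsLinearReadout.continuous (hp : Continuous p) {g : U → ℝ} (hg : IsLinearReadout p g) :
    Continuous g := by
  obtain ⟨n, -, f, hf, ζ, ℓ, H⟩ := exists_isReadout_of_isLinearReadout fun _ : Fin 1 => hg
  obtain ⟨G, hG⟩ := exists_continuous_isReadout (T := T) hf ζ ℓ
  have : ∀ u, g u = G (p u) 0 := fun u => by rw [(hG (p u)).unique (H u)]
  rw [funext this]
  fun_prop

/-- The algebra of the readouts of linear systems. -/
def linearReadoutAlgebra (p : U → V1 T d) : Subalgebra ℝ C(U, ℝ) where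
  carrier := {g | IsLinearReadout p g}
  mul_mem' hg hh := IsLinearReadout.mul hg hh
  add_mem' hg hh := IsLinearReadout.add hg hh
  algebraMap_mem' r := isLinearReadout_initial (ContinuousMap.const _ r)

/-- Uniqueness of signatures concerns only paths with a common start; different starting points are
separated by a coordinate of the initial value. -/
theorem linearReadoutAlgebra_separatesPoints (hp : Continuous p) (hinj : Function.Injective p)
    (hsig : HasUniqueSignatures (range p)) : (linearReadoutAlgebra p).SeparatesPoints := by
  intro u u' huu
  have hne := hinj.ne huu
  by_cases h0 : onReal (p u).toCont 0 = onReal (p u').toCont 0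
  · obtain ⟨M, hM⟩ := hsig _ ⟨u, rfl⟩ _ ⟨u', rfl⟩ hne h0
    obtain ⟨w, hw⟩ := Function.ne_iff.1 hM
    have hr := isLinearReadout_iteratedIntegral (p := p) w.1.reverse
    exact ⟨_, ⟨⟨_, hr.continuous hp⟩, hr, rfl⟩, hw⟩
  · obtain ⟨k, hk⟩ : ∃ k, onReal (p u).toCont 0 k ≠ onReal (p u').toCont 0 k := by
      by_contra! h
      exact h0 (by ext k; exact h k)
    have hr := isLinearReadout_initial (p := p) ⟨fun v : E d => v k, by fun_prop⟩
    exact ⟨_, ⟨⟨_, hr.continuous hp⟩, hr, rfl⟩, hk⟩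

theorem norm_le_sum_norm_coord {n : ℕ} (y : E n) : ‖y‖ ≤ ∑ k, ‖y k‖ := by
  have h : y = ∑ k, EuclideanSpace.single k (y k) := by
    ext j
    simp [Finset.sum_apply, Pi.single_apply]
  calc ‖y‖ = ‖∑ k, EuclideanSpace.single k (y k)‖ := by rw [← h]
    _ ≤ ∑ k, ‖EuclideanSpace.single k (y k)‖ := norm_sum_le _ _
    _ = ∑ k, ‖y k‖ := by simp

theorem exists_isReadout_near [CompactSpace U] (hp : Continuous p) (hinj : Function.Injective p)
    (hsig : HasUniqueSignatures (range p)) {m : ℕ} (G : C(U, E m)) {ε : ℝ} (hε : 0 < ε) :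
    ∃ n : ℕ, 1 ≤ n ∧ ∃ f ∈ lipschitzFields d n, ∃ (ζ : C(E d, E n)) (ℓ : E n →ₗ[ℝ] E m),
      ∀ u, ∃ v, IsReadout f ζ ℓ (p u) v ∧ ‖v - G u‖ < ε := by
  have hε' : 0 < ε / (m + 1) := by positivity
  choose g hg using fun k : Fin m =>
    ContinuousMap.exists_mem_subalgebra_near_continuous_of_separatesPoints _
      (linearReadoutAlgebra_separatesPoints hp hinj hsig) (fun u => G u k) (by fun_prop) _ hε'
  obtain ⟨n, hn, f, hf, ζ, ℓ, H⟩ := exists_isReadout_of_isLinearReadout fun k => (g k).2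
  refine ⟨n, hn, f, hf, ζ, ℓ, fun u => ⟨_, H u, ?_⟩⟩
  refine (norm_le_sum_norm_coord _).trans_lt ?_
  calc _ ≤ ∑ _k : Fin m, ε / (m + 1) := Finset.sum_le_sum fun k _ => (hg k u).le
    _ = m * (ε / (m + 1)) := by simp
    _ < (m + 1) * (ε / (m + 1)) := by
        gcongr
        linarith
    _ = ε := by field_simp

end LinearReadout

/-! ### Universal approximation on compact sets -/

theorem mem_closure_iff_forall_isCompact {X Y : Type*} [TopologicalSpace X]
    [SeminormedAddCommGroup Y] {S : Set C(X, Y)} {g : C(X, Y)} :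
    g ∈ closure S ↔ ∀ K, IsCompact K → ∀ ε > 0, ∃ h ∈ S, ∀ x ∈ K, ‖h x - g x‖ < ε := by
  have hb := nhds_basis_uniformity' (x := g)
    (Metric.uniformity_basis_dist (α := Y)).compactConvergenceUniformity
  rw [mem_closure_iff_nhds_basis hb]
  simp only [Prod.forall, and_imp]
  refine forall_congr' fun K => forall_comm.trans (forall_congr' fun hK => forall₂_congr
    fun ε _ => exists_congr fun h => and_congr_right fun _ => forall₂_congr fun x _ => ?_)
  simp [dist_eq_norm, norm_sub_rev]

/-! ### Perturbation of the field and of the initial map -/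

section Perturbation

variable {T : ℝ} [hT : Fact (0 < T)] {dx : ℕ}

/-- The projection of `ℝ^n` onto the cube `[-R, R]^n`. -/
def clamp {n : ℕ} (R : ℝ) (y : E n) : E n := WithLp.toLp 2 fun i => max (min R (y i)) (-R)

theorem lipschitzWith_clamp {n : ℕ} (R : ℝ) : LipschitzWith 1 (clamp R : E n → E n) := by
  refine LipschitzWith.of_dist_le_mul fun y z => ?_
  rw [NNReal.coe_one, one_mul, EuclideanSpace.dist_eq, EuclideanSpace.dist_eq]
  refine Real.sqrt_le_sqrt (Finset.sum_le_sum fun i _ => ?_)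
  gcongr
  rw [Real.dist_eq, Real.dist_eq]
  refine (abs_max_sub_max_le_abs (min R (y i)) (min R (z i)) (-R)).trans ?_
  simpa [min_comm R] using abs_min_sub_min_le_max (y i) R (z i) R

theorem clamp_of_norm_le {n : ℕ} {R : ℝ} {y : E n} (hy : ‖y‖ ≤ R) : clamp R y = y := by
  ext i
  have := abs_le.1 ((PiLp.norm_apply_le y i).trans hy)
  change max (min R (y i)) (-R) = y i
  rw [min_eq_right this.2, max_eq_left this.1]

theorem norm_clamp_le {n : ℕ} {R : ℝ} (hR : 0 ≤ R) (y : E n) : ‖clamp R y‖ ≤ n * R := by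
  refine (norm_le_sum_norm_coord _).trans ?_
  calc _ ≤ ∑ _i : Fin n, R := Finset.sum_le_sum fun i _ => by
        change |max (min R (y i)) (-R)| ≤ R
        rw [abs_le]
        exact ⟨le_max_right _ _, max_le (min_le_left _ _) (by linarith)⟩
    _ = _ := by simp

theorem IsCDESolution.congr_field {dy : ℕ} {f f' : VectorField dx dy} {ζ : C(E dx, E dy)}
    {x : V1 T dx} {y : C(Icc (0 : ℝ) T, E dy)} (h : IsCDESolution f ζ x y)
    (hff : ∀ s ∈ Icc 0 T, f (onReal y s) = f' (onReal y s)) : IsCDESolution f' ζ x y := by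
  obtain ⟨h0, hp⟩ := isCDESolution_iff.1 h
  exact isCDESolution_iff.2 ⟨h0, hp.congr hff fun _ _ => rfl⟩

/-- Density gives closeness to `f₀` on a compact set only. Composing both fields with `clamp R`
makes the closeness global without raising Lipschitz constants. The clamped solutions then stay
within `κ ≤ 1` of `z₀`, where the clamp is inactive, so they solve the original equations. -/
theorem exists_isReadout_perturbation {n m : ℕ} {f₀ : VectorField dx n}
    (hf₀ : f₀ ∈ lipschitzFields dx n) (ζ₀ : C(E dx, E n)) (ℓ : E n →ₗ[ℝ] E m)
    {F : Set (VectorField dx n)} (hF : F ⊆ lipschitzFields dx n) (hFd : Dense F)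
    {Ξ : Set C(E dx, E n)} (hΞ : Dense Ξ) (B : ℝ) {η : ℝ} (hη : 0 < η) :
    ∃ f ∈ F, ∃ ζ ∈ Ξ, ∀ x : V1 T dx, ‖x‖ ≤ B → ∀ v, IsReadout f₀ ζ₀ ℓ x v →
      ∃ v', IsReadout f ζ ℓ x v' ∧ ‖v' - v‖ < η := by
  obtain ⟨L, hL⟩ := hf₀
  rcases lt_or_ge B 0 with hB | hB
  · obtain ⟨f, hf⟩ := hFd.nonempty
    obtain ⟨ζ, hζ⟩ := hΞ.nonempty
    exact ⟨f, hf, ζ, hζ, fun x hx => absurd (hx.trans_lt hB) (norm_nonneg x).not_gt⟩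
  obtain ⟨M, hM⟩ := (isCompact_closedBall (0 : E dx) B).exists_bound_of_continuousOn
    ζ₀.continuous.continuousOn
  have hM0 : 0 ≤ M := (norm_nonneg _).trans (hM 0 (by simpa using hB))
  set K := Real.exp (L * B)
  have hK : 0 < K := Real.exp_pos _
  -- The a priori bound for the unperturbed solutions, plus `1` as room for the perturbation.
  set R := (M + ‖f₀ 0‖ * B) * K + 1
  have hR : 0 ≤ R := by positivity
  let A := LinearMap.toContinuousLinearMap ℓ
  set κ := min 1 (η / (‖A‖ + 1))
  have hκ : 0 < κ := lt_min one_pos (by positivity)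
  -- Chosen so that an error `σ` in both field and initial map becomes exactly `κ` after Gronwall.
  set σ := κ / ((1 + B) * K)
  have hσ : 0 < σ := by positivity
  have hσK : (σ + σ * B) * K = κ := by
    simp only [σ]
    field_simp
  obtain ⟨ζ, hζ, hζn⟩ := mem_closure_iff_forall_isCompact.1 (hΞ ζ₀) _
    (isCompact_closedBall (0 : E dx) B) σ hσ
  obtain ⟨f, hf, hfn⟩ := mem_closure_iff_forall_isCompact.1 (hFd f₀) _
    (isCompact_closedBall (0 : E n) (n * R)) σ hσ
  refine ⟨f, hf, ζ, hζ, fun x hx v hv => ?_⟩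
  obtain ⟨z₀, hz₀, -, rfl⟩ := hv
  have hx0 : onReal x.toCont 0 ∈ Metric.closedBall (0 : E dx) B := by
    simpa using (x.norm_onReal_le 0).trans hx
  have hz₀R : ∀ t ∈ Icc 0 T, ‖onReal z₀ t‖ ≤ R - 1 := fun t ht => by
    refine (hz₀.norm_le hL ht).trans ?_
    simp only [R, K, add_sub_cancel_right]
    gcongr
    exact hM _ hx0
  let π : C(E n, E n) := ⟨clamp R, (lipschitzWith_clamp R).continuous⟩
  have hLπ : LipschitzWith L (f₀.comp π) := by
    have := hL.comp (lipschitzWith_clamp (n := n) R)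
    rwa [mul_one] at this
  have hfπ : f.comp π ∈ lipschitzFields dx n := by
    obtain ⟨L', hL'⟩ := hF hf
    exact ⟨_, hL'.comp (lipschitzWith_clamp (n := n) R)⟩
  have hz₀π : IsCDESolution (f₀.comp π) ζ₀ x z₀ := hz₀.congr_field fun s hs => by
    change _ = f₀ (clamp R (onReal z₀ s))
    rw [clamp_of_norm_le (by linarith [hz₀R s hs])]
  obtain ⟨z, hz⟩ := exists_isCDESolution hfπ ζ x
  have hclose : ∀ t ∈ Icc 0 T, ‖onReal z t - onReal z₀ t‖ ≤ κ := fun t ht => by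
    refine (hz₀π.norm_sub_le hz hLπ hσ.le (fun s _ => ?_) ht).trans ?_
    · refine (hfn (clamp R (onReal z s)) ?_).le
      simpa using norm_clamp_le hR _
    · rw [← hσK]
      simp only [K]
      gcongr
      exact (hζn _ hx0).le
  have hzf : IsCDESolution f ζ x z := hz.congr_field fun s hs => by
    change f (clamp R (onReal z s)) = _
    rw [clamp_of_norm_le]
    have h1 := norm_le_norm_add_norm_sub' (onReal z s) (onReal z₀ s)
    have h2 := hclose s hs
    have h3 : κ ≤ 1 := min_le_left _ _
    linarith [hz₀R s hs]
  refine ⟨_, ⟨z, hzf, fun z' hz' => hzf.unique (hF hf) hz', rfl⟩, ?_⟩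
  rw [← map_sub]
  calc ‖A (onReal z T - onReal z₀ T)‖ ≤ ‖A‖ * κ :=
        A.le_opNorm_of_le (hclose T right_mem_Icc_of_fact)
    _ ≤ ‖A‖ * (η / (‖A‖ + 1)) := by
        gcongr
        exact min_le_right _ _
    _ = (‖A‖ / (‖A‖ + 1)) * η := by ring
    _ < 1 * η := by
        gcongr
        rw [div_lt_one (by positivity)]
        linarith
    _ = η := one_mul _

end Perturbation

section Universal

variable {T : ℝ} [hT : Fact (0 < T)] {dx m : ℕ} {U : Type*} [TopologicalSpace U]
  {p : U → V1 T dx} {F : ∀ dy : ℕ, Set (VectorField dx dy)} {Ξ : ∀ dy : ℕ, Set C(E dx, E dy)}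

theorem universalApproximation_of_near (hp : Continuous p)
    (hF : ∀ dy, 1 ≤ dy → F dy ⊆ lipschitzFields dx dy)
    (h : ∀ Q : Set U, IsCompact Q → ∀ G : C(U, E m), ∀ ε > 0, ∃ n, 1 ≤ n ∧ ∃ f ∈ F n, ∃ ζ ∈ Ξ n,
      ∃ ℓ : E n →ₗ[ℝ] E m, ∀ u ∈ Q, ∃ v, IsReadout f ζ ℓ (p u) v ∧ ‖v - G u‖ < ε) :
    UniversalApproximation p F Ξ m := by
  have hwd : ∀ dy : ℕ, 1 ≤ dy → ∀ f ∈ F dy, ∀ ζ ∈ Ξ dy, ∀ ℓ : E dy →ₗ[ℝ] E m,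
      ∃ g : C(U, E m), ∀ u, IsReadout f ζ ℓ (p u) (g u) := by
    intro dy hdy f hf ζ _ ℓ
    obtain ⟨g, hg⟩ := exists_continuous_isReadout (T := T) (hF dy hdy hf) ζ ℓ
    exact ⟨g.comp ⟨p, hp⟩, fun u => hg (p u)⟩
  refine ⟨hwd, fun G => mem_closure_iff_forall_isCompact.2 fun Q hQ ε hε => ?_⟩
  obtain ⟨n, hn, f, hf, ζ, hζ, ℓ, H⟩ := h Q hQ G ε hε
  obtain ⟨g, hg⟩ := hwd n hn f hf ζ hζ ℓ
  refine ⟨g, ⟨n, hn, f, hf, ζ, hζ, ℓ, hg⟩, fun u hu => ?_⟩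
  obtain ⟨v, hv, hvG⟩ := H u hu
  rwa [(hg u).unique hv]

theorem exists_isReadout_near_on (hp : Continuous p) (hinj : Function.Injective p)
    (hsig : HasUniqueSignatures (range p)) {Q : Set U} (hQ : IsCompact Q) (G : C(U, E m)) {ε : ℝ}
    (hε : 0 < ε) :
    ∃ n : ℕ, 1 ≤ n ∧ ∃ f ∈ lipschitzFields dx n, ∃ (ζ : C(E dx, E n)) (ℓ : E n →ₗ[ℝ] E m),
      ∀ u ∈ Q, ∃ v, IsReadout f ζ ℓ (p u) v ∧ ‖v - G u‖ < ε := by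
  have : CompactSpace Q := isCompact_iff_compactSpace.1 hQ
  obtain ⟨n, hn, f, hf, ζ, ℓ, H⟩ := exists_isReadout_near (p := fun u : Q => p u)
    (hp.comp continuous_subtype_val) (hinj.comp Subtype.val_injective)
    (fun x ⟨u, hu⟩ x' ⟨u', hu'⟩ => hsig x ⟨u, hu⟩ x' ⟨u', hu'⟩) (G.restrict Q) hε
  exact ⟨n, hn, f, hf, ζ, ℓ, fun u hu => H ⟨u, hu⟩⟩

theorem universalApproximation_lipschitz (hp : Continuous p) (hinj : Function.Injective p)
    (hsig : HasUniqueSignatures (range p)) :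
    UniversalApproximation p (fun dy => lipschitzFields dx dy) (fun _ => univ) m := by
  refine universalApproximation_of_near hp (fun _ _ => Subset.rfl) fun Q hQ G ε hε => ?_
  obtain ⟨n, hn, f, hf, ζ, ℓ, H⟩ := exists_isReadout_near_on hp hinj hsig hQ G hε
  exact ⟨n, hn, f, hf, ζ, mem_univ _, ℓ, H⟩

theorem universalApproximation_of_dense (hp : Continuous p) (hinj : Function.Injective p)
    (hsig : HasUniqueSignatures (range p))
    (hF : ∀ dy, 1 ≤ dy → F dy ⊆ lipschitzFields dx dy ∧ Dense (F dy))
    (hΞ : ∀ dy, 1 ≤ dy → Dense (Ξ dy)) : UniversalApproximation p F Ξ m := by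
  refine universalApproximation_of_near hp (fun dy h => (hF dy h).1) fun Q hQ G ε hε => ?_
  obtain ⟨n, hn, f₀, hf₀, ζ₀, ℓ, H⟩ := exists_isReadout_near_on hp hinj hsig hQ G (half_pos hε)
  obtain ⟨B, hB⟩ := hQ.exists_bound_of_continuousOn hp.continuousOn
  obtain ⟨f, hf, ζ, hζ, H'⟩ := exists_isReadout_perturbation (T := T) hf₀ ζ₀ ℓ (hF n hn).1
    (hF n hn).2 (hΞ n hn) B (half_pos hε)
  refine ⟨n, hn, f, hf, ζ, hζ, ℓ, fun u hu => ?_⟩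
  obtain ⟨v, hv, hvG⟩ := H u hu
  obtain ⟨v', hv', hvv⟩ := H' (p u) (hB u hu) v hv
  refine ⟨v', hv', ?_⟩
  have := norm_add_le (v' - v) (v - G u)
  rw [sub_add_sub_cancel] at this
  linarith

end Universal

/-! ### Completeness of `𝒱¹` and compactness of bounded families of interpolations -/

section Compactness

variable {T : ℝ} {d : ℕ}

namespace V1

theorem norm_toCont_le (x : V1 T d) : ‖x.toCont‖ ≤ ‖x‖ := by
  rw [norm_def]
  have : 0 ≤ (eVariationOn x.toCont univ).toReal := ENNReal.toReal_nonneg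
  linarith

theorem eVariationOn_toCont_le (x : V1 T d) :
    eVariationOn x.toCont univ ≤ ENNReal.ofReal ‖x‖ := by
  have hx : eVariationOn x.toCont univ ≠ ∞ := x.2
  rw [← ENNReal.ofReal_toReal hx]
  refine ENNReal.ofReal_le_ofReal ?_
  rw [norm_def]
  have : 0 ≤ ‖x.toCont‖ := norm_nonneg _
  linarith

theorem norm_le_of_le (x : V1 T d) {a b : ℝ} (hb : 0 ≤ b) (h1 : ‖x.toCont‖ ≤ a)
    (h2 : eVariationOn x.toCont univ ≤ ENNReal.ofReal b) : ‖x‖ ≤ a + b := by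
  rw [norm_def]
  exact add_le_add h1 (ENNReal.toReal_le_of_le_ofReal hb h2)

theorem toCont_sub (x y : V1 T d) : (x - y).toCont = x.toCont - y.toCont := rfl

/-- A Cauchy sequence has a uniform limit. Lower semicontinuity of the variation, applied to `u m -
u n` as `m → ∞`, gives both bounded variation of the limit and convergence in variation. -/
instance : CompleteSpace (V1 T d) := by
  refine Metric.complete_of_cauchySeq_tendsto fun u hu => ?_
  have hcau : CauchySeq fun n => (u n).toCont := by
    rw [Metric.cauchySeq_iff] at hu ⊢
    intro ε hε
    obtain ⟨N, hN⟩ := hu ε hε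
    refine ⟨N, fun m hm n hn => lt_of_le_of_lt ?_ (hN m hm n hn)⟩
    rw [dist_eq_norm, dist_eq_norm, ← toCont_sub]
    exact norm_toCont_le _
  obtain ⟨y, hy⟩ := cauchySeq_tendsto_of_complete hcau
  have hpt : ∀ t, Tendsto (fun n => (u n).toCont t) atTop (𝓝 (y t)) := fun t =>
    ((continuous_eval_const (F := C(Icc (0 : ℝ) T, E d)) t).tendsto y).comp hy
  rw [Metric.cauchySeq_iff] at hu
  have key : ∀ ε > 0, ∃ N, ∀ n ≥ N, eVariationOn (⇑y - ⇑(u n).toCont) univ ≤ ENNReal.ofReal ε := by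
    intro ε hε
    obtain ⟨N, hN⟩ := hu ε hε
    refine ⟨N, fun n hn => ?_⟩
    by_contra! hlt
    have := eVariationOn.lowerSemicontinuous_aux
      (F := fun m t => (u m).toCont t - (u n).toCont t) (p := atTop)
      (fun t _ => (hpt t).sub tendsto_const_nhds) hlt
    obtain ⟨m, hm, hmN⟩ := (this.and (eventually_ge_atTop N)).exists
    have h1 := eVariationOn_toCont_le (u m - u n)
    have h2 := hN m hmN n hn
    rw [dist_eq_norm] at h2
    exact absurd (hm.trans_le h1) (not_lt.2 (ENNReal.ofReal_le_ofReal h2.le))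
  have hbv : BoundedVariationOn y univ := by
    obtain ⟨N, hN⟩ := key 1 one_pos
    have h1 := eVariationOn_add_le (⇑y - ⇑(u N).toCont) (⇑(u N).toCont) univ
    rw [sub_add_cancel] at h1
    exact ne_top_of_le_ne_top (ENNReal.add_ne_top.2
      ⟨ne_top_of_le_ne_top ENNReal.ofReal_ne_top (hN N le_rfl), (u N).2⟩) h1
  obtain ⟨z, rfl⟩ : ∃ z : V1 T d, z.toCont = y := ⟨(⟨y, hbv⟩ : bvSubgroup T d), rfl⟩
  refine ⟨z, Metric.tendsto_atTop.2 fun ε hε => ?_⟩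
  obtain ⟨N, hN⟩ := key (ε / 3) (by positivity)
  obtain ⟨N', hN'⟩ := Metric.tendsto_atTop.1 hy (ε / 3) (by positivity)
  refine ⟨max N N', fun n hn => ?_⟩
  rw [dist_comm, dist_eq_norm]
  refine lt_of_le_of_lt (norm_le_of_le _ (a := ε / 3) (b := ε / 3) (by positivity) ?_
    (hN n ((le_max_left _ _).trans hn))) (by linarith)
  have := (hN' n ((le_max_right _ _).trans hn)).le
  rw [dist_comm, dist_eq_norm] at this
  exact this

end V1

theorem intervalIntegrable_of_boundedVariationOn {v : ℝ → E d} {a b : ℝ} (hab : a ≤ b)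
    (hv : BoundedVariationOn v (Icc a b)) :
    IntervalIntegrable v MeasureTheory.volume a b := by
  have hk : ∀ k, IntervalIntegrable (fun t => v t k) MeasureTheory.volume a b := fun k => by
    have hl : LipschitzWith 1 fun y : E d => y k := by
      refine LipschitzWith.of_dist_le_mul fun y z => ?_
      rw [NNReal.coe_one, one_mul, dist_eq_norm, dist_eq_norm]
      exact PiLp.norm_apply_le (y - z) k
    obtain ⟨f, g, hf, hg, hfg⟩ := (hl.comp_boundedVariationOn
      hv).locallyBoundedVariationOn.exists_monotoneOn_sub_monotoneOn
    change IntervalIntegrable ((fun y : E d => y k) ∘ v) _ a b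
    rw [hfg]
    rw [← uIcc_of_le hab] at hf hg
    exact hf.intervalIntegrable.sub hg.intervalIntegrable
  have hsum : v = fun t => ∑ k, v t k • EuclideanSpace.single k (1 : ℝ) := by
    ext t j
    simp [Finset.sum_apply, Pi.single_apply]
  rw [hsum]
  rw [intervalIntegrable_iff]
  exact MeasureTheory.integrable_finsetSum _ fun k _ =>
    ((intervalIntegrable_iff.1 (hk k)).smul_const _)

variable [hT : Fact (0 < T)]

/-- `v` is a derivative of bounded variation of the path `x`. -/
def IsBVDerivative (x : V1 T d) (v : ℝ → E d) : Prop :=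
  BoundedVariationOn v (Icc 0 T) ∧ ∀ t ∈ Icc (0 : ℝ) T,
    onReal x.toCont t = onReal x.toCont 0 + ∫ s in (0 : ℝ)..t, v s

theorem IsBVDerivative.sub_eq_integral {x : V1 T d} {v : ℝ → E d} (h : IsBVDerivative x v)
    {s t : ℝ} (hs : s ∈ Icc 0 T) (ht : t ∈ Icc 0 T) :
    onReal x.toCont t - onReal x.toCont s = ∫ r in s..t, v r := by
  have hi := intervalIntegrable_of_boundedVariationOn hT.out.le h.1
  rw [h.2 t ht, h.2 s hs, add_sub_add_left_eq_sub,
    intervalIntegral.integral_interval_sub_left (hi.mono_set ?_) (hi.mono_set ?_)]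
  · rw [uIcc_of_le ht.1, uIcc_of_le hT.out.le]; exact Icc_subset_Icc_right ht.2
  · rw [uIcc_of_le hs.1, uIcc_of_le hT.out.le]; exact Icc_subset_Icc_right hs.2

/-- On `[a, b]` the two derivatives differ by at most their difference at `a` plus their variations;
this is a Lipschitz constant for `x - x'` there. -/
theorem eVariationOn_sub_le_of_isBVDerivative {x x' : V1 T d} {v v' : ℝ → E d}
    (h : IsBVDerivative x v) (h' : IsBVDerivative x' v') {a b : ℝ} (ha : 0 ≤ a) (hab : a ≤ b)
    (hb : b ≤ T) :
    eVariationOn (onReal (x - x').toCont) (Icc a b)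
      ≤ (eVariationOn v (Icc a b) + eVariationOn v' (Icc a b) + ENNReal.ofReal ‖v a - v' a‖)
        * ENNReal.ofReal (b - a) := by
  have hsub : Icc a b ⊆ Icc 0 T := Icc_subset_Icc ha hb
  have hv := h.1.mono hsub
  have hv' := h'.1.mono hsub
  set K : NNReal := (eVariationOn v (Icc a b)).toNNReal + (eVariationOn v' (Icc a b)).toNNReal
    + ‖v a - v' a‖.toNNReal with hK
  have hKe : (K : ℝ≥0∞) = eVariationOn v (Icc a b) + eVariationOn v' (Icc a b)
      + ENNReal.ofReal ‖v a - v' a‖ := by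
    rw [hK, ENNReal.coe_add, ENNReal.coe_add, ENNReal.coe_toNNReal hv, ENNReal.coe_toNNReal hv']
    rfl
  have hKr : (K : ℝ) = (eVariationOn v (Icc a b)).toReal + (eVariationOn v' (Icc a b)).toReal
      + ‖v a - v' a‖ := by
    rw [hK, NNReal.coe_add, NNReal.coe_add, Real.coe_toNNReal _ (norm_nonneg _)]
    rfl
  have hi := intervalIntegrable_of_boundedVariationOn hT.out.le h.1
  have hi' := intervalIntegrable_of_boundedVariationOn hT.out.le h'.1
  have haI : a ∈ Icc a b := ⟨le_rfl, hab⟩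
  have hlip : LipschitzOnWith K (onReal (x - x').toCont) (Icc a b) := by
    refine LipschitzOnWith.of_dist_le_mul fun t ht s hs => ?_
    have hst : uIcc s t ⊆ uIcc 0 T := by
      rw [uIcc_of_le hT.out.le]
      exact (uIcc_subset_Icc hs ht).trans hsub
    have e1 : onReal (x - x').toCont t - onReal (x - x').toCont s = ∫ r in s..t, (v r - v' r) := by
      rw [intervalIntegral.integral_sub (hi.mono_set hst) (hi'.mono_set hst),
        ← h.sub_eq_integral (hsub hs) (hsub ht), ← h'.sub_eq_integral (hsub hs) (hsub ht),
        V1.onReal_sub, V1.onReal_sub]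
      abel
    rw [dist_eq_norm, e1, Real.dist_eq]
    refine intervalIntegral.norm_integral_le_of_norm_le_const fun r hr => ?_
    have hrI : r ∈ Icc a b := uIcc_subset_Icc hs ht (uIoc_subset_uIcc hr)
    have d1 := hv.dist_le hrI haI
    have d2 := hv'.dist_le hrI haI
    rw [dist_eq_norm] at d1 d2
    have e2 : v r - v' r = (v r - v a) - (v' r - v' a) + (v a - v' a) := by abel
    rw [e2, hKr]
    exact (norm_add_le _ _).trans (by gcongr; exact (norm_sub_le _ _).trans (add_le_add d1 d2))
  calc _ ≤ (K : ℝ≥0∞) * eVariationOn id (Icc a b) :=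
        hlip.comp_eVariationOn_le (g := id) (mapsTo_id _)
    _ = _ := by rw [hKe, eVariationOn_id_Icc]

theorem V1.eVariationOn_toCont_le_onReal (x : V1 T d) :
    eVariationOn x.toCont univ ≤ eVariationOn (onReal x.toCont) (Icc 0 T) := by
  have : (x.toCont : Icc (0 : ℝ) T → E d) = onReal x.toCont ∘ Subtype.val := by
    ext1 t
    exact (onReal_of_mem _ t.2).symm
  rw [this]
  exact eVariationOn.comp_le_of_monotoneOn _ _ (Subtype.mono_coe _ |>.monotoneOn _) fun t _ => t.2

theorem V1.norm_le_of_eVariationOn_onReal_le (x : V1 T d) {b : ℝ} (hb : 0 ≤ b)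
    (h : eVariationOn (onReal x.toCont) (Icc 0 T) ≤ ENNReal.ofReal b) :
    ‖x‖ ≤ ‖onReal x.toCont 0‖ + 2 * b := by
  have h1 := x.eVariationOn_toCont_le_onReal.trans h
  have : ‖x.toCont‖ ≤ ‖onReal x.toCont 0‖ + b := by
    rw [ContinuousMap.norm_le _ (by positivity)]
    intro t
    have hbv : BoundedVariationOn (onReal x.toCont) (Icc 0 T) :=
      ne_top_of_le_ne_top ENNReal.ofReal_ne_top h
    have h2 := hbv.dist_le t.2 zero_mem_Icc
    have h3 := ENNReal.toReal_le_of_le_ofReal hb h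
    rw [dist_eq_norm, onReal_of_mem _ t.2] at h2
    have h4 := norm_le_norm_add_norm_sub' (x.toCont t) (onReal x.toCont 0)
    exact h4.trans (by gcongr; exact h2.trans h3)
  linarith [x.norm_le_of_le hb this h1]

/-- Summed over `N` equal cells, the local variations of the derivatives add up to at most `2 * B`
and are multiplied by the cell length `T / N`. The samples of the derivatives thus determine the
path up to a small error. -/
theorem norm_sub_le_of_isBVDerivative {x x' : V1 T d} {v v' : ℝ → E d}
    (h : IsBVDerivative x v) (h' : IsBVDerivative x' v') {B η : ℝ} (hB : 0 ≤ B) (hη : 0 ≤ η)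
    (hv : (eVariationOn v (Icc 0 T)).toReal ≤ B) (hv' : (eVariationOn v' (Icc 0 T)).toReal ≤ B)
    {N : ℕ} (hN : 0 < N)
    (hd : ∀ i < N, ‖v (i * (T / N)) - v' (i * (T / N))‖ ≤ η) :
    ‖x - x'‖ ≤ ‖onReal x.toCont 0 - onReal x'.toCont 0‖ + 2 * (2 * B * T / N + η * T) := by
  have hN' : (0 : ℝ) < N := by exact_mod_cast hN
  have hT0 := hT.out
  have hpos : 0 < T / N := by positivity
  rw [← V1.onReal_sub]
  refine V1.norm_le_of_eVariationOn_onReal_le _ (by positivity) ?_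
  set I : ℕ → ℝ := fun i => i * (T / N) with hI
  have hmono : Monotone I := fun i j hij => by
    simp only [hI]
    gcongr
  have hI0 : I 0 = 0 := by simp [hI]
  have hIN : I N = T := by simp only [hI]; field_simp
  have hstep : ∀ i, I (i + 1) - I i = T / N := fun i => by simp only [hI]; push_cast; ring
  have hsum := fun f : ℝ → E d => eVariationOn.sum' f hmono (n := N)
  simp only [hI0, hIN] at hsum
  have hbv : ∀ w : ℝ → E d, BoundedVariationOn w (Icc 0 T) →
      (eVariationOn w (Icc 0 T)).toReal ≤ B → eVariationOn w (Icc 0 T) ≤ ENNReal.ofReal B :=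
    fun w hw hwB => by
      rw [← ENNReal.ofReal_toReal hw]
      exact ENNReal.ofReal_le_ofReal hwB
  rw [← hsum]
  calc _ ≤ ∑ i ∈ Finset.range N, (eVariationOn v (Icc (I i) (I (i + 1)))
          + eVariationOn v' (Icc (I i) (I (i + 1))) + ENNReal.ofReal η)
          * ENNReal.ofReal (T / N) := by
        refine Finset.sum_le_sum fun i hi => ?_
        rw [Finset.mem_range] at hi
        refine (eVariationOn_sub_le_of_isBVDerivative h h' (hI0 ▸ hmono (Nat.zero_le i))
          (hmono (Nat.le_succ i)) (hIN ▸ hmono hi)).trans ?_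
        rw [hstep]
        gcongr
        exact hd i hi
    _ = (eVariationOn v (Icc 0 T) + eVariationOn v' (Icc 0 T) + N * ENNReal.ofReal η)
          * ENNReal.ofReal (T / N) := by
        rw [← Finset.sum_mul, Finset.sum_add_distrib, Finset.sum_add_distrib, hsum, hsum]
        simp
    _ ≤ (ENNReal.ofReal B + ENNReal.ofReal B + N * ENNReal.ofReal η) * ENNReal.ofReal (T / N) := by
        gcongr
        exacts [hbv v h.1 hv, hbv v' h'.1 hv']
    _ = ENNReal.ofReal (2 * B * T / N + η * T) := by
        rw [← ENNReal.ofReal_add hB hB, ← ENNReal.ofReal_natCast, ← ENNReal.ofReal_mul hN'.le,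
          ← ENNReal.ofReal_add (by positivity) (by positivity),
          ← ENNReal.ofReal_mul (by positivity)]
        congr 1
        field_simp
        ring

/-- The starting value and the grid samples of the derivative range over a bounded set of a
finite-dimensional space; a finite net there discretizes `S`. -/
theorem totallyBounded_of_isBVDerivative {S : Set (V1 T d)} {B : ℝ}
    (hS : ∀ x ∈ S, ∃ v, IsBVDerivative x v ∧ ‖x.toCont‖ ≤ B ∧ (∀ t ∈ Icc 0 T, ‖v t‖ ≤ B) ∧
      (eVariationOn v (Icc 0 T)).toReal ≤ B) : TotallyBounded S := by
  refine Metric.totallyBounded_of_finite_discretization fun ε hε => ?_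
  rcases S.eq_empty_or_nonempty with rfl | ⟨x₀, hx₀⟩
  · exact ⟨PUnit, inferInstance, fun _ => PUnit.unit, fun x => x.2.elim⟩
  have hB : 0 ≤ B := by
    obtain ⟨v, -, h, -⟩ := hS x₀ hx₀
    exact (norm_nonneg _).trans h
  have hT0 := hT.out
  choose! v hv hx hvB hvar using hS
  obtain ⟨N, hN⟩ := exists_nat_gt (8 * B * T / ε)
  have hN' : (0 : ℝ) < N := lt_of_le_of_lt (by positivity) hN
  have hN0 : 0 < N := by exact_mod_cast hN'
  -- The samples then cost `η * (1 + 2 * T) = ε / 4`, while the choice of `N` keeps the variation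
  -- term below `ε / 2`.
  set η := ε / (4 * (1 + 2 * T))
  have hη : 0 < η := by positivity
  let Θ : S → E d × (Fin N → E d) := fun x =>
    (onReal x.1.toCont 0, fun i => v x.1 (i * (T / N)))
  have hΘ : ∀ x, Θ x ∈ Metric.closedBall (0 : E d × (Fin N → E d)) B := by
    intro x
    rw [mem_closedBall_zero_iff, Prod.norm_def]
    refine max_le ?_ ((pi_norm_le_iff_of_nonneg hB).2 fun i => hvB x x.2 _ ⟨by positivity, ?_⟩)
    · change ‖onReal x.1.toCont 0‖ ≤ B
      rw [onReal_of_mem _ zero_mem_Icc]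
      exact (ContinuousMap.norm_coe_le_norm _ _).trans (hx x x.2)
    · have : (i : ℝ) * (T / N) ≤ N * (T / N) := by
        gcongr
        exact_mod_cast i.2.le
      refine this.trans_eq ?_
      field_simp
  obtain ⟨t, -, htf, ht⟩ := (isCompact_closedBall (0 : E d × (Fin N → E d)) B).finite_cover_balls
    (half_pos hη)
  have hcov : ∀ x, ∃ y : t, dist (Θ x) y.1 < η / 2 := fun x => by
    have := ht (hΘ x)
    simp only [mem_iUnion, Metric.mem_ball] at this
    obtain ⟨y, hy, hxy⟩ := this
    exact ⟨⟨y, hy⟩, hxy⟩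
  choose F hF using hcov
  refine ⟨t, htf.fintype, F, fun x y hxy => ?_⟩
  have hdist : ‖Θ x - Θ y‖ ≤ η := by
    rw [← dist_eq_norm]
    have h1 := hF x
    have h2 := hF y
    rw [← hxy, dist_comm] at h2
    linarith [dist_triangle (Θ x) (F x).1 (Θ y)]
  rw [dist_eq_norm]
  refine (norm_sub_le_of_isBVDerivative (hv x x.2) (hv y y.2) hB hη.le (hvar x x.2) (hvar y y.2)
    hN0 fun i hi => ?_).trans_lt ?_
  · exact (norm_le_pi_norm (Θ x - Θ y).2 ⟨i, hi⟩).trans ((norm_snd_le _).trans hdist)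
  · have h1 : ‖onReal x.1.toCont 0 - onReal y.1.toCont 0‖ ≤ η :=
      (norm_fst_le (Θ x - Θ y)).trans hdist
    have h2 : 2 * B * T / N < ε / 4 := by
      rw [div_lt_iff₀ hε] at hN
      rw [div_lt_iff₀ hN']
      linarith
    have h3 : η * (1 + 2 * T) = ε / 4 := by
      simp only [η]
      field_simp
    linarith

theorem isCompact_closure_range_path {I : Interpolation d T} (hI : I.IsBounded)
    (hsize : ∃ C : ℝ, 0 < C ∧ ∀ τ ∈ I.dom, τ.size < C) : IsCompact (closure (range I.path)) := by
  obtain ⟨C, hC, H⟩ := hI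
  obtain ⟨C', hC', hs⟩ := hsize
  refine TotallyBounded.isCompact_of_isClosed (TotallyBounded.closure
    (totallyBounded_of_isBVDerivative (B := C * C') ?_)) isClosed_closure
  rintro _ ⟨τ, rfl⟩
  obtain ⟨v, hv, hvi, hb⟩ := H τ
  have hCs : C * τ.1.size ≤ C * C' := by
    gcongr
    exact (hs τ τ.2).le
  have h1 : 0 ≤ ‖(I.path τ).toCont‖ := norm_nonneg _
  have h2 : 0 ≤ ⨆ t : Icc (0 : ℝ) T, ‖v t‖ := Real.iSup_nonneg fun _ => norm_nonneg _
  have h3 : 0 ≤ (eVariationOn v (Icc 0 T)).toReal := ENNReal.toReal_nonneg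
  refine ⟨v, ⟨hv, hvi⟩, by linarith, fun t ht => ?_, by linarith⟩
  -- Without this the real supremum could take its default value `0` and would not bound `v`
  -- pointwise.
  have hbdd : BddAbove (range fun t : Icc (0 : ℝ) T => ‖v t‖) := by
    refine ⟨‖v 0‖ + (eVariationOn v (Icc 0 T)).toReal, ?_⟩
    rintro _ ⟨s, rfl⟩
    have d1 := hv.dist_le s.2 zero_mem_Icc
    rw [dist_eq_norm] at d1
    exact (norm_le_norm_add_norm_sub' (v s) (v 0)).trans (by gcongr)
  have := le_ciSup hbdd ⟨t, ht⟩
  simp only at this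
  linarith

end Compactness

end NeuralCDE

theorem mainTheorem2 (T : ℝ) [Fact (0 < T)] (dx m : ℕ) :
    -- paths: `K` compact in `𝒱¹([0, T]; ℝ^dx)` with uniqueness of signatures
    (∀ K : Set (NeuralCDE.V1 T dx), IsCompact K → NeuralCDE.HasUniqueSignatures K →
      NeuralCDE.UniversalApproximation (fun x : K => (x : NeuralCDE.V1 T dx))
        (fun dy => NeuralCDE.lipschitzFields dx dy) (fun _ => Set.univ) m) ∧
    -- time series
    (∀ (F : ∀ dy : ℕ, Set (NeuralCDE.VectorField (2 * dx + 1) dy))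
      (Ξ : ∀ dy : ℕ, Set C(NeuralCDE.E (2 * dx + 1), NeuralCDE.E dy)),
      (∀ dy : ℕ, 1 ≤ dy →
        F dy ⊆ NeuralCDE.lipschitzFields (2 * dx + 1) dy ∧ Dense (F dy)) →
      (∀ dy : ℕ, 1 ≤ dy → Dense (Ξ dy)) →
      ∀ I : NeuralCDE.Interpolation dx T, I.IsBounded → I.IsSignatureUnique →
        (∃ C : ℝ, 0 < C ∧ ∀ τ ∈ I.dom, τ.size < C) →
        NeuralCDE.UniversalApproximation I.path F Ξ m ∧
        -- uniform approximation over the whole (possibly non-compact) data set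
        IsCompact (closure (Set.range I.path)) ∧
        (NeuralCDE.HasUniqueSignatures (closure (Set.range I.path)) →
          NeuralCDE.UniversalApproximation
            (fun x : closure (Set.range I.path) => (x : NeuralCDE.V1 T (2 * dx + 1)))
            F Ξ m)) := by
  refine ⟨fun K _ hsig => ?_, fun F Ξ hF hΞ I hb hsig hsize => ⟨?_, ?_, fun hsig' => ?_⟩⟩
  · refine NeuralCDE.universalApproximation_lipschitz continuous_subtype_val
      Subtype.val_injective ?_
    rwa [Subtype.range_coe]
  · exact NeuralCDE.universalApproximation_of_dense continuous_induced_dom hsig.1 hsig.2 hF hΞ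
  · exact NeuralCDE.isCompact_closure_range_path hb hsize
  · refine NeuralCDE.universalApproximation_of_dense continuous_subtype_val
      Subtype.val_injective ?_ hF hΞ
    rwa [Subtype.range_coe]
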